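/- **Languages.** All theories are in classical first-order logic with equality; free variables in axioms are understood as universally quantified, and in $\forall x.\,A$ the quantifier extends as far to the right as possible. The primitive logical symbols are $\neg,\land,\to,\forall$ ($\lor,\exists,\leftrightarrow$ are defined). The language $\mathcal L$ has constants $\mathsf k,\mathsf s,\mathsf p,\mathsf p_0,\mathsf p_1,\mathsf 0,\mathsf s_{\mathsf N},\mathsf p_{\mathsf N},\mathsf d_{\mathsf N}$, a binary application function $ab$ (associating to the left) and a unary predicate $\mathrm N$; write $(a,b):=\mathsf p ab$, $(a)_i:=\mathsf p_i a$, $1:=\mathsf s_{\mathsf N}\mathsf 0$. $\mathcal L_{EM}$ adds constants (generators) $\mathsf{nat},\mathsf{id},\mathsf{co},\mathsf{int},\mathsf{dom},\mathsf{inv},\mathsf j,\mathsf i$ and predicates $\mathrm R(x)$, $x\in y$. $\mathcal L_{FS}$ adds to $\mathcal L$ constants $\dot=,\dot\neg,\dot\land,\dot\to,\dot\forall,\dot{\mathsf N},\mathsf l$ and unary predicates $\mathrm T,\mathrm U$; write $x\dot= y:=\dot=(x,y)$, similarly for $\dot\land,\dot\to$, and $x\dot\lor y:=\dot\neg(\dot\neg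 x\dot\land\dot\neg y)$. A generator or other constant written with several arguments, as in $\mathsf{int}(x,y)$, is applied to the pair. **TON** (over any of these languages): $\mathsf kab=a$; $\mathsf sabc=ac(bc)$; $(a,b)_0=a\land(a,b)_1=b$; $\mathrm N(\mathsf 0)\land\forall x.\,\mathrm N(x)\to\mathrm N(\mathsf s_{\mathsf N}x)$; $\mathrm N(x)\to\mathsf s_{\mathsf N}x\ne\mathsf 0\land\mathsf p_{\mathsf N}(\mathsf s_{\mathsf N}x)=x$; $\mathrm N(x)\land x\neq\mathsf 0\to\mathrm N(\mathsf p_{\mathsf N}x)\land\mathsf s_{\mathsf N}(\mathsf p_{\mathsf N}x)=x$; $\mathrm N(a)\land\mathrm N(b)\land a=b\to\mathsf d_{\mathsf N}uvab=u$; $\mathrm N(a)\land\mathrm N(b)\land a\ne b\to\mathsf d_{\mathsf N}uvab=v$; and induction $A(\mathsf 0)\land[\forall x.\,\mathrm N(x)\land A(x)\to A(\mathsf s_{\mathsf N}x)]\to\forall x.\,\mathrm N(x)\to A(x)$ for all formulas $A$ of the language in question. **$\mathsf T_0$** is the $\mathcal L_{EM}$-theory with the axioms of TON (induction for all $\mathcal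 L_{EM}$-formulas) and: - $\mathrm R(\mathsf{nat})\land\forall x.\,x\in\mathsf{nat}\leftrightarrow\mathrm N(x)$; $\ \mathrm R(\mathsf{id})\land\forall x.\,x\in\mathsf{id}\leftrightarrow\exists y.\,x=(y,y)$; - $\mathrm R(x)\to\mathrm R(\mathsf{co}\,x)\land\forall y.\,y\in\mathsf{co}\,x\leftrightarrow y\notin x$; - $\mathrm R(x)\land\mathrm R(y)\to\mathrm R(\mathsf{int}(x,y))\land\forall z.\,z\in\mathsf{int}(x,y)\leftrightarrow z\in x\land z\in y$; - $\mathrm R(a)\to\mathrm R(\mathsf{dom}\,a)\land\forall x.\,x\in\mathsf{dom}\,a\leftrightarrow\exists y.\,(x,y)\in a$; - $\mathrm R(a)\to\mathrm R(\mathsf{inv}(a,f))\land\forall x.\,x\in\mathsf{inv}(a,f)\leftrightarrow fx\in a$; - $\mathrm R(x)\land[\forall y\in x.\,\mathrm R(fy)]\to\mathrm R(\mathsf j(x,f))\land\forall u.\,u\in\mathsf j(x,f)\leftrightarrow\exists v,w.\,u=(v,w)\land v\in x\land w\in fv$; - $(\mathsf{IG}.1)$ $\mathrm R(a)\land\mathrm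 R(b)\to\mathrm R(\mathsf i(a,b))\land\mathsf{Closed}(a,b,\bullet\in\mathsf i(a,b))$; - $(\mathsf{IG}.2)$ $\mathrm R(a)\land\mathrm R(b)\land\mathsf{Closed}(a,b,A(\bullet))\to\forall x\in\mathsf i(a,b).\,A(x)$ for all $\mathcal L_{EM}$-formulas $A$, where $\mathsf{Closed}(a,b,A(\bullet))$ is $\forall x\in a.\,[\forall y\in a.\,(y,x)\in b\to A(y)]\to A(x)$. **KFUPI.** Put $\mathrm P(x):=\mathrm T(x)\lor\mathrm T(\dot\neg x)$, $\mathrm C(f):=\forall x.\,\mathrm P(fx)$, and let $f\sqsubset g$ be $[\forall x.\,\mathrm T(fx)\to\mathrm T(g(fx))]\land[\forall x.\,\mathrm T(\dot\neg(fx))\to\mathrm T(g(\dot\neg(fx)))]$. KFUPI is the $\mathcal L_{FS}$-theory with the axioms of TON (induction for all $\mathcal L_{FS}$-formulas) and: 1. (KF) $\mathrm T(x\dot=y)\leftrightarrow x=y$; $\mathrm T(\dot\neg(x\dot=y))\leftrightarrow x\neq y$; $\mathrm T(\dot{\mathsf N}x)\leftrightarrow\mathrm N(x)$; $\mathrm T(\dot\neg(\dot{\mathsf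 N}x))\leftrightarrow\neg\mathrm N(x)$; $\mathrm T(\dot\neg(\dot\neg x))\leftrightarrow\mathrm T(x)$; $\mathrm T(x\dot\land y)\leftrightarrow\mathrm T(x)\land\mathrm T(y)$; $\mathrm T(\dot\neg(x\dot\land y))\leftrightarrow\mathrm T(\dot\neg x)\lor\mathrm T(\dot\neg y)$; $\mathrm T(x\dot\to y)\leftrightarrow\mathrm T(\dot\neg x)\lor\mathrm T(y)$; $\mathrm T(\dot\neg(x\dot\to y))\leftrightarrow\mathrm T(x)\land\mathrm T(\dot\neg y)$; $\mathrm T(\dot\forall f)\leftrightarrow\forall x.\,\mathrm T(fx)$; $\mathrm T(\dot\neg(\dot\forall f))\leftrightarrow\exists x.\,\mathrm T(\dot\neg(fx))$; $\neg[\mathrm T(x)\land\mathrm T(\dot\neg x)]$. 2. (Universes) For each axiom of KF in 1, the axiom $\mathrm U(u)\to\cdots$ in which every $\mathrm T(s)$ is replaced by $\mathrm T(us)$ (for $u$ a new variable, and with the other free variables universally quantified); and $\mathrm U(u)\to\mathrm C(u)$; $\mathrm U(u)\to\forall x.\,\mathrm T(ux)\to\mathrm T(x)$; $\mathrm C(f)\to\mathrm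 U(\mathsf lf)\land f\sqsubset\mathsf lf$. 3. $(\mathsf{UG})$ For distinct $c,d\in\{\dot=,\dot\neg,\dot\land,\dot\to,\dot\forall,\dot{\mathsf N},\mathsf l\}$: $c\ne d$, $cx\neq dy$; for each such $c$: $cx=cy\to x=y$; for each such $c$ other than $\mathsf l$: $\mathsf lfy\ne cx$; and $\mathsf lfx=\mathsf lgy\to f=g\land x=y$. 4. $(\mathsf{PI})$ $[\forall x.\,\mathscr A(B(\bullet),x)\to B(x)]\to\forall x.\,\mathrm P(x)\to B(x)$ for all $\mathcal L_{FS}$-formulas $B$, where $\mathscr A(B(\bullet),x)$ is the disjunction of: $\exists y,z.\,x=(y\dot=z)$; $\exists y.\,x=\dot{\mathsf N}y$; $\exists y.\,x=\dot\neg y\land B(y)$; $\exists y,z.\,x=(y\dot\land z)\land\{[B(y)\land B(z)]\lor[B(y)\land\mathrm T(\dot\neg y)]\lor[B(z)\land\mathrm T(\dot\neg z)]\}$; $\exists y,z.\,x=(y\dot\to z)\land\{[B(y)\land B(z)]\lor[B(y)\land\mathrm T(\dot\neg y)]\lor[B(z)\land\mathrm T(z)]\}$; $\exists g.\,x=\dot\forall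 g\land\{[\forall y.\,B(gy)]\lor\exists y.\,B(gy)\land\mathrm T(\dot\neg(gy))\}$; $\exists f,y.\,x=\mathsf lfy\land\forall z.\,B(fz)$. **The term $\mathsf{acc}$.** With $\lambda$-terms and recursion defined as usual from $\mathsf k,\mathsf s$, put $\oplus(u,v):=\lambda z.\,((z)_0\dot=\mathsf 0\,\dot\land\,u(z)_1)\,\dot\lor\,(\dot\neg((z)_0\dot=\mathsf 0)\,\dot\land\,v(z)_1)$, let $t$ be defined by recursion with $$t(u,v,w)=\dot\forall\lambda y.\,\oplus(u,v)(\mathsf 0,y)\,\dot\to\,[\oplus(u,v)(1,(y,w))\,\dot\to\,t(u,v,y)],$$ and let $\mathsf{acc}$ be the closed $\mathcal L_{FS}$-term with $$\mathsf{acc}(u,v)x=\oplus(u,v)(\mathsf 0,x)\ \dot\land\ \dot\forall\lambda y.\,\oplus(u,v)(\mathsf 0,y)\,\dot\to\,[\oplus(u,v)(1,(y,x))\,\dot\to\,\mathsf l(\oplus(u,v))(t(u,v,y))].$$ **Theorem.** There are closed $\mathcal L_{FS}$-terms interpreting the generators, with $\mathsf i$ interpreted by $\mathsf{acc}$, such that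 for the translation $'$ from $\mathcal L_{EM}$ to $\mathcal L_{FS}$ which replaces each generator by its term, $\mathrm R(x)$ by $\mathrm C(x)$ and $x\in y$ by $\mathrm T(yx)$, commutes with the logical symbols and leaves the vocabulary of $\mathcal L$ unchanged: for every $\mathcal L_{EM}$-sentence $A$, if $\mathsf T_0\vdash A$, then $\mathsf{KFUPI}\vdash A'$. Moreover, $(\mathsf{IG}.2)'$ is derivable for every $\mathcal L_{FS}$-formula $A$: $\mathsf{KFUPI}\vdash\mathrm C(a)\land\mathrm C(b)\land\big(\forall x.\,\mathrm T(ax)\to[\forall y.\,\mathrm T(ay)\to\mathrm T(b(y,x))\to A(y)]\to A(x)\big)\to\forall x.\,\mathrm T(\mathsf{acc}(a,b)x)\to A(x)$. -/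

import Mathlib

namespace FregeStructure

/-! ### First-order syntax

All languages considered here expand the applicative language `L` (constants `k, s, p, p₀, p₁, 0,
s_N, p_N, d_N`, the binary function symbol `App`, the unary predicate `N`, and equality).
An expansion is given by a type `X` of further individual constants and a family `Y` of further
relation symbols, `Y k` being those of arity `k`.

Terms and formulas are indexed by the number `n` of variables `x₀, …, x_{n-1}` that may occur free.
A quantifier in context `n` binds the new variable `x_n` (de Bruijn levels), so a variable keeps
its number when one passes below a quantifier. -/

/-- The individual constants of `L`. -/
inductive BaseConst : Type
  | k | s | p | p0 | p1 | zero | sN | pN | dN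

/-- Terms with free variables among `x₀, …, x_{n-1}`. -/
inductive Tm (X : Type) (n : ℕ) : Type
  | var (i : Fin n) : Tm X n
  | base (c : BaseConst) : Tm X n
  | ext (c : X) : Tm X n
  | app (a b : Tm X n) : Tm X n

infixl:90 " ⬝ " => Tm.app
notation "𝐱" => Tm.var

/-- Formulas with free variables among `x₀, …, x_{n-1}`; the primitive logical symbols are
equality, `¬`, `∧`, `→`, `∀`. -/
inductive Fm (X : Type) (Y : ℕ → Type) : ℕ → Type
  | eq {n : ℕ} (a b : Tm X n) : Fm X Y n
  | nat {n : ℕ} (a : Tm X n) : Fm X Y n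
  | rel {n k : ℕ} (r : Y k) (ts : Fin k → Tm X n) : Fm X Y n
  | neg {n : ℕ} (A : Fm X Y n) : Fm X Y n
  | and {n : ℕ} (A B : Fm X Y n) : Fm X Y n
  | imp {n : ℕ} (A B : Fm X Y n) : Fm X Y n
  | all {n : ℕ} (A : Fm X Y (n + 1)) : Fm X Y n

section Basics

variable {X : Type} {Y : ℕ → Type}

/-- Disjunction, as a defined symbol. -/
def Fm.or {n : ℕ} (A B : Fm X Y n) : Fm X Y n := (A.neg.and B.neg).neg

/-- Existential quantification, as a defined symbol. -/
def Fm.ex {n : ℕ} (A : Fm X Y (n + 1)) : Fm X Y n := A.neg.all.neg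

/-- Equivalence, as a defined symbol. -/
def Fm.iff {n : ℕ} (A B : Fm X Y n) : Fm X Y n := (A.imp B).and (B.imp A)

infix:70 " ≐ " => Fm.eq
prefix:max "∼" => Fm.neg
infixr:65 " ⋏ " => Fm.and
infixr:60 " ⋎ " => Fm.or
infixr:55 " ➝ " => Fm.imp
infix:50 " ⭤ " => Fm.iff

/-- Simultaneous substitution in a term. -/
def Tm.subst {n m : ℕ} (σ : Fin n → Tm X m) : Tm X n → Tm X m
  | .var i => σ i
  | .base c => .base c
  | .ext c => .ext c
  | .app a b => .app (a.subst σ) (b.subst σ)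

/-- A term of context `n`, seen in context `n + j`. -/
def Tm.wk {n : ℕ} (j : ℕ) (t : Tm X n) : Tm X (n + j) := t.subst fun i => .var (Fin.castAdd j i)

/-- A closed term, seen in any context. -/
def Tm.lift (n : ℕ) (t : Tm X 0) : Tm X n := t.subst fun i => i.elim0

/-- The substitution `σ` carried below a quantifier: the bound variable goes to itself. -/
def liftSubst {n m : ℕ} (σ : Fin n → Tm X m) : Fin (n + 1) → Tm X (m + 1) :=
  Fin.snoc (α := fun _ => Tm X (m + 1)) (fun i => (σ i).wk 1) (.var (Fin.last m))

/-- Simultaneous (capture-free) substitution in a formula. -/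
def Fm.subst : {n m : ℕ} → (Fin n → Tm X m) → Fm X Y n → Fm X Y m
  | _, _, σ, .eq a b => .eq (a.subst σ) (b.subst σ)
  | _, _, σ, .nat a => .nat (a.subst σ)
  | _, _, σ, .rel r ts => .rel r fun i => (ts i).subst σ
  | _, _, σ, .neg A => .neg (A.subst σ)
  | _, _, σ, .and A B => .and (A.subst σ) (B.subst σ)
  | _, _, σ, .imp A B => .imp (A.subst σ) (B.subst σ)
  | _, _, σ, .all A => .all (A.subst (liftSubst σ))

/-- A formula of context `n`, seen in context `n + j`. -/
def Fm.wk {n : ℕ} (j : ℕ) (A : Fm X Y n) : Fm X Y (n + j) :=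
  A.subst fun i => .var (Fin.castAdd j i)

/-- `A.at t` is `A(t)`: for a formula `A` with parameters `x₀, …, x_{m-1}` and the distinguished
variable `x_m`, the term `t` of the larger context `m + j` replaces `x_m`, and the parameters
remain. -/
def Fm.at {m j : ℕ} (A : Fm X Y (m + 1)) (t : Tm X (m + j)) : Fm X Y (m + j) :=
  A.subst (Fin.snoc (α := fun _ => Tm X (m + j)) (fun i => .var (Fin.castAdd j i)) t)

/-- Universal closure. -/
def Fm.closure : {n : ℕ} → Fm X Y n → Fm X Y 0
  | 0, A => A
  | _ + 1, A => (Fm.all A).closure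

/-- The variable `x_{m+i}` of context `m + j`. -/
def pv (m : ℕ) {j : ℕ} (i : Fin j) : Tm X (m + j) := .var (Fin.natAdd m i)

/-! ### Derivability: classical first-order logic with equality (natural deduction) -/

/-- `Derives Th Γ A`: the formula `A` is derivable from axioms in `Th` and assumptions `Γ`. -/
inductive Derives (Th : Fm X Y 0 → Prop) : {n : ℕ} → List (Fm X Y n) → Fm X Y n → Prop
  | ax {n : ℕ} {Γ : List (Fm X Y n)} {A : Fm X Y 0} (h : Th A) :
      Derives Th Γ (A.subst fun i => i.elim0)
  | hyp {n : ℕ} {Γ : List (Fm X Y n)} {A : Fm X Y n} (h : A ∈ Γ) : Derives Th Γ A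
  | negI {n : ℕ} {Γ : List (Fm X Y n)} {A B : Fm X Y n}
      (h₁ : Derives Th (A :: Γ) B) (h₂ : Derives Th (A :: Γ) ∼B) : Derives Th Γ ∼A
  | raa {n : ℕ} {Γ : List (Fm X Y n)} {A B : Fm X Y n}
      (h₁ : Derives Th (∼A :: Γ) B) (h₂ : Derives Th (∼A :: Γ) ∼B) : Derives Th Γ A
  | andI {n : ℕ} {Γ : List (Fm X Y n)} {A B : Fm X Y n}
      (h₁ : Derives Th Γ A) (h₂ : Derives Th Γ B) : Derives Th Γ (A ⋏ B)
  | andE₁ {n : ℕ} {Γ : List (Fm X Y n)} {A B : Fm X Y n}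
      (h : Derives Th Γ (A ⋏ B)) : Derives Th Γ A
  | andE₂ {n : ℕ} {Γ : List (Fm X Y n)} {A B : Fm X Y n}
      (h : Derives Th Γ (A ⋏ B)) : Derives Th Γ B
  | impI {n : ℕ} {Γ : List (Fm X Y n)} {A B : Fm X Y n}
      (h : Derives Th (A :: Γ) B) : Derives Th Γ (A ➝ B)
  | impE {n : ℕ} {Γ : List (Fm X Y n)} {A B : Fm X Y n}
      (h₁ : Derives Th Γ (A ➝ B)) (h₂ : Derives Th Γ A) : Derives Th Γ B
  | allI {n : ℕ} {Γ : List (Fm X Y n)} {A : Fm X Y (n + 1)}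
      (h : Derives Th (Γ.map (Fm.wk 1)) A) : Derives Th Γ A.all
  | allE {n : ℕ} {Γ : List (Fm X Y n)} {A : Fm X Y (n + 1)} (t : Tm X n)
      (h : Derives Th Γ A.all) : Derives Th Γ (A.at (j := 0) t)
  | eqRefl {n : ℕ} {Γ : List (Fm X Y n)} (t : Tm X n) : Derives Th Γ (t ≐ t)
  | eqSubst {n : ℕ} {Γ : List (Fm X Y n)} (A : Fm X Y (n + 1)) {a b : Tm X n}
      (h₁ : Derives Th Γ (a ≐ b)) (h₂ : Derives Th Γ (A.at (j := 0) a)) :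
      Derives Th Γ (A.at (j := 0) b)

/-- `Th ⊢ A`, for a sentence `A`. -/
def Provable (Th : Fm X Y 0 → Prop) (A : Fm X Y 0) : Prop := Derives Th [] A

/-! ### The total applicative theory -/

/-- `(a, b) := p a b`. -/
def pair {n : ℕ} (a b : Tm X n) : Tm X n := .base .p ⬝ a ⬝ b

/-- `(a)₀ := p₀ a`. -/
def fst {n : ℕ} (a : Tm X n) : Tm X n := .base .p0 ⬝ a

/-- `(a)₁ := p₁ a`. -/
def snd {n : ℕ} (a : Tm X n) : Tm X n := .base .p1 ⬝ a

/-- The constant `0`. -/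
def zero {n : ℕ} : Tm X n := .base .zero

/-- `s_N a`. -/
def suc {n : ℕ} (a : Tm X n) : Tm X n := .base .sN ⬝ a

/-- The axioms of `TON` (universal closures), with the induction schema for all formulas of the
language given by `X` and `Y`. -/
inductive TON : Fm X Y 0 → Prop
  | k : TON (Fm.closure (n := 2) (.base .k ⬝ 𝐱 0 ⬝ 𝐱 1 ≐ 𝐱 0))
  | s : TON (Fm.closure (n := 3)
      (.base .s ⬝ 𝐱 0 ⬝ 𝐱 1 ⬝ 𝐱 2 ≐ 𝐱 0 ⬝ 𝐱 2 ⬝ (𝐱 1 ⬝ 𝐱 2)))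
  | pairing : TON (Fm.closure (n := 2)
      ((fst (pair (𝐱 0) (𝐱 1)) ≐ 𝐱 0) ⋏ (snd (pair (𝐱 0) (𝐱 1)) ≐ 𝐱 1)))
  | nat : TON (.nat zero ⋏ .all (.nat (𝐱 0) ➝ .nat (suc (𝐱 0))))
  | suc : TON (.all (.nat (𝐱 0) ➝
      ∼(suc (𝐱 0) ≐ zero) ⋏ (.base .pN ⬝ suc (𝐱 0) ≐ 𝐱 0)))
  | pred : TON (.all (.nat (𝐱 0) ⋏ ∼(𝐱 0 ≐ zero) ➝
      .nat (.base .pN ⬝ 𝐱 0) ⋏ (suc (.base .pN ⬝ 𝐱 0) ≐ 𝐱 0)))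
  | cases_eq : TON (Fm.closure (n := 4) (.nat (𝐱 0) ⋏ .nat (𝐱 1) ⋏ (𝐱 0 ≐ 𝐱 1) ➝
      (.base .dN ⬝ 𝐱 2 ⬝ 𝐱 3 ⬝ 𝐱 0 ⬝ 𝐱 1 ≐ 𝐱 2)))
  | cases_ne : TON (Fm.closure (n := 4) (.nat (𝐱 0) ⋏ .nat (𝐱 1) ⋏ ∼(𝐱 0 ≐ 𝐱 1) ➝
      (.base .dN ⬝ 𝐱 2 ⬝ 𝐱 3 ⬝ 𝐱 0 ⬝ 𝐱 1 ≐ 𝐱 3)))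
  | induction {m : ℕ} (A : Fm X Y (m + 1)) : TON (Fm.closure (n := m)
      (A.at (j := 0) zero ⋏ .all (.nat (pv m (j := 1) 0) ⋏ A ➝ A.at (suc (pv m (j := 1) 0))) ➝
        .all (.nat (pv m (j := 1) 0) ➝ A)))

/-! ### Abstraction and recursion terms -/

/-- `lam t` is the combinatory term `λx_n. t`. -/
def lam {n : ℕ} : Tm X (n + 1) → Tm X n
  | .var i => Fin.lastCases (motive := fun _ => Tm X n) (.base .s ⬝ .base .k ⬝ .base .k)
      (fun j => .base .k ⬝ .var j) i
  | .base c => .base .k ⬝ .base c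
  | .ext c => .base .k ⬝ .ext c
  | .app a b => .base .s ⬝ lam a ⬝ lam b

/-- The fixed point combinator `rec = λf. (λx. f (x x)) (λx. f (x x))`. -/
def recTm : Tm X 0 := lam (lam (𝐱 0 ⬝ (𝐱 1 ⬝ 𝐱 1)) ⬝ lam (𝐱 0 ⬝ (𝐱 1 ⬝ 𝐱 1)))

end Basics

/-! ### Explicit mathematics -/

/-- The generators; `ig` is the constant `i` of inductive generation. -/
inductive Gen : Type
  | nat | id | co | int | dom | inv | join | ig

/-- The predicates `R` (unary) and `∈` (binary). -/
inductive EMRel : ℕ → Type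
  | R : EMRel 1
  | mem : EMRel 2

/-- Terms of `L_EM`. -/
abbrev EMTm (n : ℕ) : Type := Tm Gen n

/-- Formulas of `L_EM`. -/
abbrev EMFm (n : ℕ) : Type := Fm Gen EMRel n

/-- `R(a)`. -/
def isSet {n : ℕ} (a : EMTm n) : EMFm n := .rel .R ![a]

/-- `a ∈ b`. -/
def mem {n : ℕ} (a b : EMTm n) : EMFm n := .rel .mem ![a, b]

/-- `Closed(a, b, A(•)) := ∀x ∈ a. [∀y ∈ a. y <_b x → A(y)] → A(x)`, where `y <_b x` is
`(y, x) ∈ b`, and `x_n` is the distinguished variable of `A`. -/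
def closedEM {n : ℕ} (a b : EMTm n) (A : EMFm (n + 1)) : EMFm n :=
  .all (mem (pv n (j := 1) 0) (a.wk 1) ➝
    .all (n := n + 1) (mem (pv n (j := 2) 1) (a.wk 2) ➝
      mem (pair (pv n (j := 2) 1) (pv n (j := 2) 0)) (b.wk 2) ➝ A.at (pv n (j := 2) 1)) ➝
    A)

/-- The axioms of `EM`, over `TON` with induction for all formulas of `L_EM`. -/
inductive EM : EMFm 0 → Prop
  | ton {A : EMFm 0} (h : TON A) : EM A
  | nat : EM (isSet (.ext .nat) ⋏ .all (mem (𝐱 0) (.ext .nat) ⭤ .nat (𝐱 0)))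
  | id : EM (isSet (.ext .id) ⋏
      .all (mem (𝐱 0) (.ext .id) ⭤ .ex (𝐱 0 ≐ pair (𝐱 1) (𝐱 1))))
  | co : EM (Fm.closure (n := 1) (isSet (𝐱 0) ➝
      isSet (.ext .co ⬝ 𝐱 0) ⋏
        .all (mem (𝐱 1) (.ext .co ⬝ 𝐱 0) ⭤ ∼(mem (𝐱 1) (𝐱 0)))))
  | int : EM (Fm.closure (n := 2) (isSet (𝐱 0) ⋏ isSet (𝐱 1) ➝
      isSet (.ext .int ⬝ pair (𝐱 0) (𝐱 1)) ⋏
        .all (mem (𝐱 2) (.ext .int ⬝ pair (𝐱 0) (𝐱 1)) ⭤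
          mem (𝐱 2) (𝐱 0) ⋏ mem (𝐱 2) (𝐱 1))))
  | dom : EM (Fm.closure (n := 1) (isSet (𝐱 0) ➝
      isSet (.ext .dom ⬝ 𝐱 0) ⋏
        .all (mem (𝐱 1) (.ext .dom ⬝ 𝐱 0) ⭤ .ex (mem (pair (𝐱 1) (𝐱 2)) (𝐱 0)))))
  | inv : EM (Fm.closure (n := 2) (isSet (𝐱 0) ➝
      isSet (.ext .inv ⬝ pair (𝐱 0) (𝐱 1)) ⋏
        .all (mem (𝐱 2) (.ext .inv ⬝ pair (𝐱 0) (𝐱 1)) ⭤ mem (𝐱 1 ⬝ 𝐱 2) (𝐱 0))))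
  | join : EM (Fm.closure (n := 2)
      (isSet (𝐱 0) ⋏ .all (mem (𝐱 2) (𝐱 0) ➝ isSet (𝐱 1 ⬝ 𝐱 2)) ➝
        isSet (.ext .join ⬝ pair (𝐱 0) (𝐱 1)) ⋏
          .all (mem (𝐱 2) (.ext .join ⬝ pair (𝐱 0) (𝐱 1)) ⭤
            .ex (.ex ((𝐱 2 ≐ pair (𝐱 3) (𝐱 4)) ⋏ mem (𝐱 3) (𝐱 0) ⋏ mem (𝐱 4) (𝐱 1 ⬝ 𝐱 3))))))

/-- The axioms of `T₀`: those of `EM`, and inductive generation. In the schema, the formula `A`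
has the parameters `x₀, …, x_{m-1}`, `a = x_m`, `b = x_{m+1}`, and its distinguished variable
is `x_{m+2}`. -/
inductive T0 : EMFm 0 → Prop
  | em {A : EMFm 0} (h : EM A) : T0 A
  | ig1 : T0 (Fm.closure (n := 2) (isSet (𝐱 0) ⋏ isSet (𝐱 1) ➝
      isSet (.ext .ig ⬝ pair (𝐱 0) (𝐱 1)) ⋏
        closedEM (𝐱 0) (𝐱 1) (mem (𝐱 2) (.ext .ig ⬝ pair (𝐱 0) (𝐱 1)))))
  | ig2 {m : ℕ} (A : EMFm (m + 2 + 1)) : T0 (Fm.closure (n := m + 2)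
      (isSet (pv m (j := 2) 0) ⋏ isSet (pv m (j := 2) 1) ⋏
          closedEM (pv m (j := 2) 0) (pv m (j := 2) 1) A ➝
        .all (mem (pv m (j := 3) 2) (.ext .ig ⬝ pair (pv m (j := 3) 0) (pv m (j := 3) 1)) ➝ A)))

/-! ### Frege structures -/

/-- The constants `=̇, ¬̇, ∧̇, →̇, ∀̇, Ṅ` and the limit constant `l`. -/
inductive FSConst : Type
  | eq | neg | and | imp | all | nat | lim

/-- The unary predicates `T` and `U`. -/
inductive FSRel : ℕ → Type
  | T : FSRel 1
  | U : FSRel 1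

/-- Terms of `L_FS`. -/
abbrev FSTm (n : ℕ) : Type := Tm FSConst n

/-- Formulas of `L_FS`. -/
abbrev FSFm (n : ℕ) : Type := Fm FSConst FSRel n

section FS

variable {n : ℕ}

/-- `T(a)`. -/
def tr (a : FSTm n) : FSFm n := .rel .T ![a]

/-- `U(a)`. -/
def un (a : FSTm n) : FSFm n := .rel .U ![a]

/-- `a =̇ b`. -/
def dEq (a b : FSTm n) : FSTm n := .ext .eq ⬝ pair a b

/-- `¬̇ a`. -/
def dNeg (a : FSTm n) : FSTm n := .ext .neg ⬝ a

/-- `a ∧̇ b`. -/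
def dAnd (a b : FSTm n) : FSTm n := .ext .and ⬝ pair a b

/-- `a →̇ b`. -/
def dImp (a b : FSTm n) : FSTm n := .ext .imp ⬝ pair a b

/-- `∀̇ f`. -/
def dAll (f : FSTm n) : FSTm n := .ext .all ⬝ f

/-- `Ṅ a`. -/
def dNat (a : FSTm n) : FSTm n := .ext .nat ⬝ a

/-- `a ∨̇ b`, a defined operation. -/
def dOr (a b : FSTm n) : FSTm n := dNeg (dAnd (dNeg a) (dNeg b))

/-- `l f`. -/
def lim (f : FSTm n) : FSTm n := .ext .lim ⬝ f

/-- `P(a) := T(a) ∨ T(¬̇ a)`: `a` is a proposition. -/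
def isProp (a : FSTm n) : FSFm n := tr a ⋎ tr (dNeg a)

/-- `C(f) := ∀x. P(f x)`: `f` is a class. -/
def isClass (f : FSTm n) : FSFm n := .all (isProp (f.wk 1 ⬝ pv n (j := 1) 0))

/-- `f ⊏ g`: `g` reflects on `f`. -/
def reflects (f g : FSTm n) : FSFm n :=
  .all (tr (f.wk 1 ⬝ pv n (j := 1) 0) ➝ tr (g.wk 1 ⬝ (f.wk 1 ⬝ pv n (j := 1) 0))) ⋏
  .all (tr (dNeg (f.wk 1 ⬝ pv n (j := 1) 0)) ➝ tr (g.wk 1 ⬝ dNeg (f.wk 1 ⬝ pv n (j := 1) 0)))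

end FS

/-- The axioms of `KF`, over `TON` with induction for all formulas of `L_FS`. -/
inductive KF : FSFm 0 → Prop
  | ton {A : FSFm 0} (h : TON A) : KF A
  | eq : KF (Fm.closure (n := 2) (tr (dEq (𝐱 0) (𝐱 1)) ⭤ 𝐱 0 ≐ 𝐱 1))
  | ne : KF (Fm.closure (n := 2) (tr (dNeg (dEq (𝐱 0) (𝐱 1))) ⭤ ∼(𝐱 0 ≐ 𝐱 1)))
  | nat : KF (Fm.closure (n := 1) (tr (dNat (𝐱 0)) ⭤ .nat (𝐱 0)))
  | neg_nat : KF (Fm.closure (n := 1) (tr (dNeg (dNat (𝐱 0))) ⭤ ∼(.nat (𝐱 0))))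
  | neg_neg : KF (Fm.closure (n := 1) (tr (dNeg (dNeg (𝐱 0))) ⭤ tr (𝐱 0)))
  | and : KF (Fm.closure (n := 2) (tr (dAnd (𝐱 0) (𝐱 1)) ⭤ tr (𝐱 0) ⋏ tr (𝐱 1)))
  | neg_and : KF (Fm.closure (n := 2)
      (tr (dNeg (dAnd (𝐱 0) (𝐱 1))) ⭤ tr (dNeg (𝐱 0)) ⋎ tr (dNeg (𝐱 1))))
  | imp : KF (Fm.closure (n := 2) (tr (dImp (𝐱 0) (𝐱 1)) ⭤ tr (dNeg (𝐱 0)) ⋎ tr (𝐱 1)))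
  | neg_imp : KF (Fm.closure (n := 2)
      (tr (dNeg (dImp (𝐱 0) (𝐱 1))) ⭤ tr (𝐱 0) ⋏ tr (dNeg (𝐱 1))))
  | all : KF (Fm.closure (n := 1) (tr (dAll (𝐱 0)) ⭤ .all (tr (𝐱 0 ⬝ 𝐱 1))))
  | neg_all : KF (Fm.closure (n := 1)
      (tr (dNeg (dAll (𝐱 0))) ⭤ .ex (tr (dNeg (𝐱 0 ⬝ 𝐱 1)))))
  | cons : KF (Fm.closure (n := 1) ∼(tr (𝐱 0) ⋏ tr (dNeg (𝐱 0))))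

/-- The axioms of `KFU`: those of `KF`, the compositional and consistency axioms in `U`, and the
structural properties of `U`. -/
inductive KFU : FSFm 0 → Prop
  | kf {A : FSFm 0} (h : KF A) : KFU A
  | eq : KFU (.all (un (𝐱 0) ➝ .all (.all
      (tr (𝐱 0 ⬝ dEq (𝐱 1) (𝐱 2)) ⭤ 𝐱 1 ≐ 𝐱 2))))
  | ne : KFU (.all (un (𝐱 0) ➝ .all (.all
      (tr (𝐱 0 ⬝ dNeg (dEq (𝐱 1) (𝐱 2))) ⭤ ∼(𝐱 1 ≐ 𝐱 2)))))
  | nat : KFU (.all (un (𝐱 0) ➝ .all (tr (𝐱 0 ⬝ dNat (𝐱 1)) ⭤ .nat (𝐱 1))))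
  | neg_nat : KFU (.all (un (𝐱 0) ➝ .all
      (tr (𝐱 0 ⬝ dNeg (dNat (𝐱 1))) ⭤ ∼(.nat (𝐱 1)))))
  | neg_neg : KFU (.all (un (𝐱 0) ➝ .all
      (tr (𝐱 0 ⬝ dNeg (dNeg (𝐱 1))) ⭤ tr (𝐱 0 ⬝ 𝐱 1))))
  | and : KFU (.all (un (𝐱 0) ➝ .all (.all
      (tr (𝐱 0 ⬝ dAnd (𝐱 1) (𝐱 2)) ⭤ tr (𝐱 0 ⬝ 𝐱 1) ⋏ tr (𝐱 0 ⬝ 𝐱 2)))))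
  | neg_and : KFU (.all (un (𝐱 0) ➝ .all (.all
      (tr (𝐱 0 ⬝ dNeg (dAnd (𝐱 1) (𝐱 2))) ⭤
        tr (𝐱 0 ⬝ dNeg (𝐱 1)) ⋎ tr (𝐱 0 ⬝ dNeg (𝐱 2))))))
  | imp : KFU (.all (un (𝐱 0) ➝ .all (.all
      (tr (𝐱 0 ⬝ dImp (𝐱 1) (𝐱 2)) ⭤ tr (𝐱 0 ⬝ dNeg (𝐱 1)) ⋎ tr (𝐱 0 ⬝ 𝐱 2)))))
  | neg_imp : KFU (.all (un (𝐱 0) ➝ .all (.all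
      (tr (𝐱 0 ⬝ dNeg (dImp (𝐱 1) (𝐱 2))) ⭤ tr (𝐱 0 ⬝ 𝐱 1) ⋏ tr (𝐱 0 ⬝ dNeg (𝐱 2))))))
  | all : KFU (.all (un (𝐱 0) ➝ .all
      (tr (𝐱 0 ⬝ dAll (𝐱 1)) ⭤ .all (tr (𝐱 0 ⬝ (𝐱 1 ⬝ 𝐱 2))))))
  | neg_all : KFU (.all (un (𝐱 0) ➝ .all
      (tr (𝐱 0 ⬝ dNeg (dAll (𝐱 1))) ⭤ .ex (tr (𝐱 0 ⬝ dNeg (𝐱 1 ⬝ 𝐱 2))))))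
  | cons : KFU (.all (un (𝐱 0) ➝ .all
      ∼(tr (𝐱 0 ⬝ 𝐱 1) ⋏ tr (𝐱 0 ⬝ dNeg (𝐱 1)))))
  | cls : KFU (.all (un (𝐱 0) ➝ isClass (𝐱 0)))
  | true : KFU (.all (un (𝐱 0) ➝ .all (tr (𝐱 0 ⬝ 𝐱 1) ➝ tr (𝐱 1))))
  | limit : KFU (.all (isClass (𝐱 0) ➝ un (lim (𝐱 0)) ⋏ reflects (𝐱 0) (lim (𝐱 0))))

/-- The schema `(UG)`: unique decomposition of the terms built by the constants
`=̇, ¬̇, ∧̇, →̇, ∀̇, Ṅ, l`. The last two axioms concern terms `l f y`, in which `l` is applied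
to two arguments. -/
inductive UG : FSFm 0 → Prop
  | const_ne (c d : FSConst) (h : c ≠ d) : UG ∼(.ext c ≐ .ext d)
  | app_ne (c d : FSConst) (h : c ≠ d) : UG (Fm.closure (n := 2)
      ∼(.ext c ⬝ 𝐱 0 ≐ .ext d ⬝ 𝐱 1))
  | app_inj (c : FSConst) : UG (Fm.closure (n := 2)
      ((.ext c ⬝ 𝐱 0 ≐ .ext c ⬝ 𝐱 1) ➝ (𝐱 0 ≐ 𝐱 1)))
  | lim_ne (c : FSConst) (h : c ≠ .lim) : UG (Fm.closure (n := 3)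
      ∼(lim (𝐱 0) ⬝ 𝐱 1 ≐ .ext c ⬝ 𝐱 2))
  | lim_inj : UG (Fm.closure (n := 4)
      ((lim (𝐱 0) ⬝ 𝐱 1 ≐ lim (𝐱 2) ⬝ 𝐱 3) ➝ (𝐱 0 ≐ 𝐱 2) ⋏ (𝐱 1 ≐ 𝐱 3)))

/-- The operator `𝒜(B(•), x)` of the inductive characterisation of propositions. The formula `B`
has the parameters `x₀, …, x_{m-1}` and the distinguished variable `x_m`; `x` is `x_m`. -/
def opA {m : ℕ} (B : FSFm (m + 1)) : FSFm (m + 1) :=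
  .ex (.ex (n := m + 2) (pv m (j := 3) 0 ≐ dEq (pv m (j := 3) 1) (pv m (j := 3) 2))) ⋎
  .ex (n := m + 1) (pv m (j := 2) 0 ≐ dNat (pv m (j := 2) 1)) ⋎
  .ex (n := m + 1) ((pv m (j := 2) 0 ≐ dNeg (pv m (j := 2) 1)) ⋏ B.at (pv m (j := 2) 1)) ⋎
  .ex (.ex (n := m + 2) ((pv m (j := 3) 0 ≐ dAnd (pv m (j := 3) 1) (pv m (j := 3) 2)) ⋏
    ((B.at (pv m (j := 3) 1) ⋏ B.at (pv m (j := 3) 2)) ⋎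
      (B.at (pv m (j := 3) 1) ⋏ tr (dNeg (pv m (j := 3) 1))) ⋎
      (B.at (pv m (j := 3) 2) ⋏ tr (dNeg (pv m (j := 3) 2)))))) ⋎
  .ex (.ex (n := m + 2) ((pv m (j := 3) 0 ≐ dImp (pv m (j := 3) 1) (pv m (j := 3) 2)) ⋏
    ((B.at (pv m (j := 3) 1) ⋏ B.at (pv m (j := 3) 2)) ⋎
      (B.at (pv m (j := 3) 1) ⋏ tr (dNeg (pv m (j := 3) 1))) ⋎
      (B.at (pv m (j := 3) 2) ⋏ tr (pv m (j := 3) 2))))) ⋎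
  .ex (n := m + 1) ((pv m (j := 2) 0 ≐ dAll (pv m (j := 2) 1)) ⋏
    (.all (n := m + 2) (B.at (pv m (j := 3) 1 ⬝ pv m (j := 3) 2)) ⋎
      .ex (n := m + 2) (B.at (pv m (j := 3) 1 ⬝ pv m (j := 3) 2) ⋏
        tr (dNeg (pv m (j := 3) 1 ⬝ pv m (j := 3) 2))))) ⋎
  .ex (.ex (n := m + 2) ((pv m (j := 3) 0 ≐ lim (pv m (j := 3) 1) ⬝ pv m (j := 3) 2) ⋏
    .all (n := m + 3) (B.at (pv m (j := 4) 1 ⬝ pv m (j := 4) 3))))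

/-- The axioms of `KFUPI`: those of `KFU`, the schema `(UG)`, and proposition induction
`[∀x. 𝒜(B(•), x) → B(x)] → ∀x. P(x) → B(x)` for all formulas `B` of `L_FS`. -/
inductive KFUPI : FSFm 0 → Prop
  | kfu {A : FSFm 0} (h : KFU A) : KFUPI A
  | ug {A : FSFm 0} (h : UG A) : KFUPI A
  | pi {m : ℕ} (B : FSFm (m + 1)) : KFUPI (Fm.closure (n := m)
      (.all (opA B ➝ B) ➝ .all (isProp (pv m (j := 1) 0) ➝ B)))

/-! ### The accessibility term -/

/-- `⊕(u, v) = λz. ((z)₀ =̇ 0 ∧̇ u (z)₁) ∨̇ (¬̇((z)₀ =̇ 0) ∧̇ v (z)₁)`. -/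
def oplus {n : ℕ} (u v : FSTm n) : FSTm n :=
  lam (dOr
    (dAnd (dEq (fst (pv n (j := 1) 0)) zero) (u.wk 1 ⬝ snd (pv n (j := 1) 0)))
    (dAnd (dNeg (dEq (fst (pv n (j := 1) 0)) zero)) (v.wk 1 ⬝ snd (pv n (j := 1) 0))))

/-- `∀̇y. ⊕(u, v)(0, y) →̇ (⊕(u, v)(1, (y, w)) →̇ r)`, where `y` is the last variable of `r`. -/
def predAll {n : ℕ} (u v w : FSTm n) (r : FSTm (n + 1)) : FSTm n :=
  dAll (lam (dImp ((oplus u v).wk 1 ⬝ pair zero (pv n (j := 1) 0))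
    (dImp ((oplus u v).wk 1 ⬝ pair (suc zero) (pair (pv n (j := 1) 0) (w.wk 1))) r)))

/-- The term `t(u, v, ·)`, obtained by recursion, with
`t(u, v, w) = ∀̇y. ⊕(u, v)(0, y) →̇ (⊕(u, v)(1, (y, w)) →̇ t(u, v, y))`: it is
`rec (λh. λw. ∀̇y. ⊕(u, v)(0, y) →̇ (⊕(u, v)(1, (y, w)) →̇ h y))`. -/
def accRec {n : ℕ} (u v : FSTm n) : FSTm n :=
  recTm.lift n ⬝ lam (lam (n := n + 1)
    (predAll (u.wk 2) (v.wk 2) (pv n (j := 2) 1) (pv n (j := 3) 0 ⬝ pv n (j := 3) 2)))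

/-- `acc(u, v)`, the term `λx. ⊕(u, v)(0, x) ∧̇
  ∀̇y. ⊕(u, v)(0, y) →̇ (⊕(u, v)(1, (y, x)) →̇ l(⊕(u, v))(t(u, v, y)))`. -/
def accOf {n : ℕ} (u v : FSTm n) : FSTm n :=
  lam (dAnd ((oplus u v).wk 1 ⬝ pair zero (pv n (j := 1) 0))
    (predAll (u.wk 1) (v.wk 1) (pv n (j := 1) 0)
      (lim ((oplus u v).wk 2) ⬝ ((accRec u v).wk 2 ⬝ pv n (j := 2) 1))))

/-- The closed term `acc`, to be applied to a pair: `acc(a, b)` is `acc` applied to `(a, b)`. -/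
def acc : FSTm 0 := lam (accOf (fst (𝐱 0)) (snd (𝐱 0)))

/-! ### The translation -/

/-- Translation of terms: the vocabulary of `L` is unchanged, and each generator is replaced by a
closed term of `L_FS`. -/
def transTm (τ : Gen → FSTm 0) {n : ℕ} : EMTm n → FSTm n
  | .var i => .var i
  | .base c => .base c
  | .ext g => (τ g).lift n
  | .app a b => .app (transTm τ a) (transTm τ b)

/-- Translation of the atomic formulas: `R(a)` becomes `C(a)`, and `a ∈ b` becomes `T(b a)`. -/
def transRel {n : ℕ} : {k : ℕ} → EMRel k → (Fin k → FSTm n) → FSFm n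
  | _, .R, ts => isClass (ts 0)
  | _, .mem, ts => tr (ts 1 ⬝ ts 0)

/-- The translation `A ↦ A'` from `L_EM` to `L_FS` determined by terms for the generators. -/
def trans (τ : Gen → FSTm 0) : {n : ℕ} → EMFm n → FSFm n
  | _, .eq a b => .eq (transTm τ a) (transTm τ b)
  | _, .nat a => .nat (transTm τ a)
  | _, .rel r ts => transRel r fun i => transTm τ (ts i)
  | _, .neg A => .neg (trans τ A)
  | _, .and A B => .and (trans τ A) (trans τ B)
  | _, .imp A B => .imp (trans τ A) (trans τ B)
  | _, .all A => .all (trans τ A)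

/-- `Closed'(a, b, A(•))`, with `T(a x)` for `x ∈ a` and `T(b (y, x))` for `y <_b x`, where `x_n`
is the distinguished variable of `A`. -/
def closedFS {n : ℕ} (a b : FSTm n) (A : FSFm (n + 1)) : FSFm n :=
  .all (tr (a.wk 1 ⬝ pv n (j := 1) 0) ➝
    .all (n := n + 1) (tr (a.wk 2 ⬝ pv n (j := 2) 1) ➝
      tr (b.wk 2 ⬝ pair (pv n (j := 2) 1) (pv n (j := 2) 0)) ➝ A.at (pv n (j := 2) 1)) ➝
    A)

/-- `(IG.2)'` for an arbitrary formula `A` of `L_FS`, with parameters `x₀, …, x_{m-1}`, `a = x_m`,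
`b = x_{m+1}`, and the distinguished variable `x_{m+2}` (universal closure). -/
def accInduction {m : ℕ} (A : FSFm (m + 2 + 1)) : FSFm 0 :=
  Fm.closure (n := m + 2)
    (isClass (pv m (j := 2) 0) ⋏ isClass (pv m (j := 2) 1) ⋏
        closedFS (pv m (j := 2) 0) (pv m (j := 2) 1) A ➝
      .all (tr (acc.lift (m + 3) ⬝ pair (pv m (j := 3) 0) (pv m (j := 3) 1) ⬝ pv m (j := 3) 2) ➝ A))

end FregeStructure

/-! Derivability in KFUPI is established semantically. By completeness (`provable_of_holds`) it
suffices to verify both claims in an arbitrary model `M` of KFUPI. The translation turns `M` into an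
$\mathcal L_{EM}$-structure `M.reduct genTm` on the same domain, with $\mathrm R$ read as being a
class and $x\in y$ as $\mathrm T(yx)$. By `holds_trans`, $A'$ holds in `M` exactly if $A$ holds in
the reduct. So it is enough that the reduct is a model of $\mathsf T_0$ (`reduct_models_T0`);
soundness does the rest. Since `M` is arbitrary, induction on numbers and on propositions is
available only for properties defined by formulas with parameters.

The elementary generators are given by their defining propositions. The substance is inductive
generation. The classes $a,b$ are coded by one class $e=\oplus(a,b)$, and the universe $\mathsf l e$
decides every $ez$ correctly. The fixed point $t$ makes $tw$ the proposition-like object "$ty$ for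
all predecessors $y$ of $w$". Read in the universe this is a genuine equivalence (`accRec_iff`).
While $tw$ itself is not known to be a proposition, $\mathsf l e$ is total, so $\mathsf{acc}(a,b)$
is a class (`acc_C`). Membership in it amounts to lying in $a$ and satisfying $\mathsf l e(tx)$
(`acc_iff_and`), whence closure (`acc_closed`).

For induction (`acc_induction`), truth of $\mathsf l e(tx)$ makes $tx$ true, hence a proposition, so
proposition induction applies. It descends from $tx$ through one $\dot\forall$ and two implications
to $ty$ for each predecessor $y$. Since the quantified statement and the antecedents met on the way
are true, the cases of $\mathscr A$ justified by a false component are excluded (`OpA.of_dAll`,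
`OpA.of_dImp`), and (UG) makes the decomposition unique. -/

namespace FregeStructure

/-! ### Substitution calculus. -/

section Substitution

variable {X : Type} {Y : ℕ → Type}

/-- The assignment `ρ`, extended by the value `d` of the next variable. -/
def push {D : Type} {n : ℕ} (ρ : Fin n → D) (d : D) : Fin (n + 1) → D :=
  Fin.snoc (α := fun _ => D) ρ d

@[simp] theorem push_last {D : Type} {n : ℕ} (ρ : Fin n → D) (d : D) :
    push ρ d (Fin.last n) = d := by simp [push]

@[simp] theorem push_castSucc {D : Type} {n : ℕ} (ρ : Fin n → D) (d : D) (i : Fin n) :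
    push ρ d i.castSucc = ρ i := by simp [push]

@[simp] theorem push_castAdd_one {D : Type} {n : ℕ} (ρ : Fin n → D) (d : D) (i : Fin n) :
    push ρ d (Fin.castAdd 1 i) = ρ i := push_castSucc ρ d i

theorem push_castAdd {D : Type} {m j : ℕ} (ρ : Fin (m + j) → D) (d : D) (i : Fin m) :
    push ρ d (Fin.castAdd (j + 1) i) = ρ (Fin.castAdd j i) :=
  push_castSucc ρ d (Fin.castAdd j i)

theorem comp_push {D E : Type} {n : ℕ} (f : D → E) (ρ : Fin n → D) (d : D) :
    (fun i => f (push ρ d i)) = push (fun i => f (ρ i)) (f d) := by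
  funext i
  induction i using Fin.lastCases <;> simp

@[simp] theorem liftSubst_last {n m : ℕ} (σ : Fin n → Tm X m) :
    liftSubst σ (Fin.last n) = .var (Fin.last m) := by simp [liftSubst]

@[simp] theorem liftSubst_castSucc {n m : ℕ} (σ : Fin n → Tm X m) (i : Fin n) :
    liftSubst σ i.castSucc = (σ i).wk 1 := by simp [liftSubst]

theorem Tm.subst_subst {n m k : ℕ} (σ : Fin n → Tm X m) (τ : Fin m → Tm X k) (t : Tm X n) :
    (t.subst σ).subst τ = t.subst fun i => (σ i).subst τ := by
  induction t with
  | var i => rfl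
  | base c => rfl
  | ext c => rfl
  | app a b iha ihb => simp [Tm.subst, iha, ihb]

theorem Tm.subst_var {n : ℕ} (t : Tm X n) : t.subst Tm.var = t := by
  induction t with
  | var i => rfl
  | base c => rfl
  | ext c => rfl
  | app a b iha ihb => simp [Tm.subst, iha, ihb]

theorem liftSubst_comp {n m k : ℕ} (σ : Fin n → Tm X m) (τ : Fin m → Tm X k) :
    (fun i => (liftSubst σ i).subst (liftSubst τ)) = liftSubst fun i => (σ i).subst τ := by
  funext i
  induction i using Fin.lastCases with
  | last => simp [Tm.subst]
  | cast i =>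
    simp only [liftSubst_castSucc, Tm.wk, Tm.subst_subst]
    congr 1
    funext j
    exact liftSubst_castSucc τ j

theorem liftSubst_var {n : ℕ} : liftSubst (Tm.var : Fin n → Tm X n) = Tm.var := by
  funext i
  induction i using Fin.lastCases with
  | last => simp
  | cast i => simp [Tm.wk, Tm.subst]; rfl

theorem Fm.subst_subst {n m k : ℕ} (σ : Fin n → Tm X m) (τ : Fin m → Tm X k) (A : Fm X Y n) :
    (A.subst σ).subst τ = A.subst fun i => (σ i).subst τ := by
  induction A generalizing m k with
  | eq a b => simp [Fm.subst, Tm.subst_subst]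
  | nat a => simp [Fm.subst, Tm.subst_subst]
  | rel r ts => simp [Fm.subst, Tm.subst_subst]
  | neg A ih => simp [Fm.subst, ih]
  | and A B ihA ihB => simp [Fm.subst, ihA, ihB]
  | imp A B ihA ihB => simp [Fm.subst, ihA, ihB]
  | all A ih => simp [Fm.subst, ih, liftSubst_comp]

theorem Fm.subst_var {n : ℕ} (A : Fm X Y n) : A.subst Tm.var = A := by
  induction A with
  | eq a b => simp [Fm.subst, Tm.subst_var]
  | nat a => simp [Fm.subst, Tm.subst_var]
  | rel r ts => simp [Fm.subst, Tm.subst_var]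
  | neg A ih => simp [Fm.subst, ih]
  | and A B ihA ihB => simp [Fm.subst, ihA, ihB]
  | imp A B ihA ihB => simp [Fm.subst, ihA, ihB]
  | all A ih => simp [Fm.subst, ih, liftSubst_var]

theorem Fm.at_eq_subst_push {n : ℕ} (A : Fm X Y (n + 1)) (t : Tm X n) :
    A.at (j := 0) t = A.subst (push Tm.var t) := rfl

theorem Fm.subst_at {n m : ℕ} (σ : Fin n → Tm X m) (A : Fm X Y (n + 1)) (t : Tm X n) :
    (A.at (j := 0) t).subst σ = (A.subst (liftSubst σ)).at (j := 0) (t.subst σ) := by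
  simp only [Fm.at_eq_subst_push, Fm.subst_subst]
  congr 1
  funext i
  induction i using Fin.lastCases with
  | last => simp [Tm.subst]
  | cast i =>
    simp only [push_castSucc, liftSubst_castSucc, Tm.wk, Tm.subst_subst, Tm.subst]
    simp [Tm.subst_var]

theorem Fm.wk_at {n : ℕ} (A : Fm X Y n) (t : Tm X n) : (A.wk 1).at (j := 0) t = A := by
  simp only [Fm.at_eq_subst_push, Fm.wk, Fm.subst_subst, Tm.subst, push_castAdd_one]
  exact Fm.subst_var A

theorem Fm.subst_wk {n m : ℕ} (σ : Fin n → Tm X m) (A : Fm X Y n) :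
    (A.wk 1).subst (liftSubst σ) = (A.subst σ).wk 1 := by
  simp only [Fm.wk, Fm.subst_subst, Tm.subst]
  congr 1
  funext i
  exact liftSubst_castSucc σ i

end Substitution

/-! ### Models and soundness -/

/-- Structures for the language given by `X` and `Y`, with equality read as identity. -/
structure Model (X : Type) (Y : ℕ → Type) where
  /-- The universe of the structure. -/
  D : Type
  /-- The denotations of the constants of `L`. -/
  base : BaseConst → D
  /-- The denotations of the further constants. -/
  ext : X → D
  /-- Application. -/
  app : D → D → D
  /-- The extension of `N`. -/
  nat : D → Prop
  /-- The extensions of the further relation symbols. -/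
  rel : {k : ℕ} → Y k → (Fin k → D) → Prop

section Semantics

variable {X : Type} {Y : ℕ → Type} {M : Model X Y}

/-- The denotation of a term. -/
def Tm.eval (M : Model X Y) {n : ℕ} (ρ : Fin n → M.D) : Tm X n → M.D
  | .var i => ρ i
  | .base c => M.base c
  | .ext c => M.ext c
  | .app a b => M.app (a.eval M ρ) (b.eval M ρ)

/-- Satisfaction of a formula. -/
def Fm.holds (M : Model X Y) : {n : ℕ} → (Fin n → M.D) → Fm X Y n → Prop
  | _, ρ, .eq a b => a.eval M ρ = b.eval M ρ
  | _, ρ, .nat a => M.nat (a.eval M ρ)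
  | _, ρ, .rel r ts => M.rel r fun i => (ts i).eval M ρ
  | _, ρ, .neg A => ¬A.holds M ρ
  | _, ρ, .and A B => A.holds M ρ ∧ B.holds M ρ
  | _, ρ, .imp A B => A.holds M ρ → B.holds M ρ
  | _, ρ, .all A => ∀ d, A.holds M (push ρ d)

theorem Tm.eval_subst {n m : ℕ} (σ : Fin n → Tm X m) (ρ : Fin m → M.D) (t : Tm X n) :
    (t.subst σ).eval M ρ = t.eval M fun i => (σ i).eval M ρ := by
  induction t with
  | var i => rfl
  | base c => rfl
  | ext c => rfl
  | app a b iha ihb => simp [Tm.subst, Tm.eval, iha, ihb]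

theorem Tm.eval_wk {n j : ℕ} (ρ : Fin (n + j) → M.D) (t : Tm X n) :
    (t.wk j).eval M ρ = t.eval M fun i => ρ (Fin.castAdd j i) := Tm.eval_subst _ _ _

theorem Tm.eval_wk_one {n : ℕ} (ρ : Fin n → M.D) (d : M.D) (t : Tm X n) :
    (t.wk 1).eval M (push ρ d) = t.eval M ρ := by
  rw [Tm.eval_wk]
  simp only [push_castAdd_one]

theorem Tm.eval_wk_two {n : ℕ} (ρ : Fin n → M.D) (d e : M.D) (t : Tm X n) :
    (t.wk 2).eval M (push (push ρ d) e) = t.eval M ρ := by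
  refine (Tm.eval_wk (j := 2) (push (push ρ d) e) t).trans (congrArg (fun ρ => t.eval M ρ) ?_)
  funext i
  exact (push_castAdd (j := 1) (push ρ d) e i).trans (push_castAdd_one ρ d i)

theorem Tm.eval_lift {n : ℕ} (ρ : Fin n → M.D) (t : Tm X 0) :
    (t.lift n).eval M ρ = t.eval M Fin.elim0 :=
  (Tm.eval_subst _ _ _).trans (congrArg (fun ρ => t.eval M ρ) (funext fun i => i.elim0))

theorem Fm.holds_subst {n m : ℕ} (σ : Fin n → Tm X m) (ρ : Fin m → M.D) (A : Fm X Y n) :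
    (A.subst σ).holds M ρ ↔ A.holds M fun i => (σ i).eval M ρ := by
  induction A generalizing m with
  | eq a b => simp [Fm.subst, Fm.holds, Tm.eval_subst]
  | nat a => simp [Fm.subst, Fm.holds, Tm.eval_subst]
  | rel r ts => simp [Fm.subst, Fm.holds, Tm.eval_subst]
  | neg A ih => simp [Fm.subst, Fm.holds, ih]
  | and A B ihA ihB => simp [Fm.subst, Fm.holds, ihA, ihB]
  | imp A B ihA ihB => simp [Fm.subst, Fm.holds, ihA, ihB]
  | all A ih =>
    simp only [Fm.subst, Fm.holds, ih]
    refine forall_congr' fun d => ?_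
    have h : (fun i => (liftSubst σ i).eval M (push ρ d)) =
        push (fun i => (σ i).eval M ρ) d := by
      funext i
      induction i using Fin.lastCases with
      | last => simp [Tm.eval]
      | cast i => simp [Tm.eval_wk_one]
    rw [h]

theorem Fm.holds_at {m j : ℕ} (A : Fm X Y (m + 1)) (t : Tm X (m + j)) (ρ : Fin (m + j) → M.D) :
    (A.at t).holds M ρ ↔ A.holds M (push (fun i => ρ (Fin.castAdd j i)) (t.eval M ρ)) := by
  have h : (fun i => (push (fun i => Tm.var (Fin.castAdd j i)) t i).eval M ρ) =
      push (fun i => ρ (Fin.castAdd j i)) (t.eval M ρ) := comp_push (Tm.eval M ρ) _ t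
  rw [← h]
  exact Fm.holds_subst _ _ _

theorem Fm.holds_at_zero {n : ℕ} (A : Fm X Y (n + 1)) (t : Tm X n) (ρ : Fin n → M.D) :
    (A.at (j := 0) t).holds M ρ ↔ A.holds M (push ρ (t.eval M ρ)) :=
  Fm.holds_at (j := 0) A t ρ

theorem Fm.holds_wk_one {n : ℕ} (ρ : Fin n → M.D) (d : M.D) (A : Fm X Y n) :
    (A.wk 1).holds M (push ρ d) ↔ A.holds M ρ := by
  refine (Fm.holds_subst _ _ _).trans ?_
  simp only [Tm.eval, push_castAdd_one]

theorem Fm.holds_closure : ∀ {n : ℕ} (A : Fm X Y n) (ρ : Fin 0 → M.D),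
    A.closure.holds M ρ ↔ ∀ ρ : Fin n → M.D, A.holds M ρ
  | 0, A, ρ => ⟨fun h ρ' => Subsingleton.elim ρ ρ' ▸ h, fun h => h ρ⟩
  | n + 1, A, ρ => by
    refine (Fm.holds_closure A.all ρ).trans ⟨fun h ρ' => ?_, fun h ρ' d => h _⟩
    have := h (fun i => ρ' i.castSucc) (ρ' (Fin.last n))
    have e : push (fun i => ρ' i.castSucc) (ρ' (Fin.last n)) = ρ' := by
      funext i
      induction i using Fin.lastCases <;> simp
    rwa [e] at this

theorem Fm.holds_or {n : ℕ} (A B : Fm X Y n) (ρ : Fin n → M.D) :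
    (A ⋎ B).holds M ρ ↔ A.holds M ρ ∨ B.holds M ρ := by
  simp only [Fm.or, Fm.holds]
  tauto

theorem Fm.holds_ex {n : ℕ} (A : Fm X Y (n + 1)) (ρ : Fin n → M.D) :
    A.ex.holds M ρ ↔ ∃ d, A.holds M (push ρ d) := by
  simp [Fm.ex, Fm.holds]

theorem Fm.holds_iff {n : ℕ} (A B : Fm X Y n) (ρ : Fin n → M.D) :
    (A ⭤ B).holds M ρ ↔ (A.holds M ρ ↔ B.holds M ρ) := by
  simp only [Fm.iff, Fm.holds]
  tauto

/-- `M` is a model of the theory `Th`. -/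
def Model.Models (M : Model X Y) (Th : Fm X Y 0 → Prop) : Prop :=
  ∀ A, Th A → A.holds M Fin.elim0

theorem Derives.sound {Th : Fm X Y 0 → Prop} (hM : M.Models Th) {n : ℕ} {Γ : List (Fm X Y n)}
    {A : Fm X Y n} (h : Derives Th Γ A) (ρ : Fin n → M.D) (hΓ : ∀ B ∈ Γ, B.holds M ρ) :
    A.holds M ρ := by
  induction h with
  | @ax n Γ A h =>
    rw [Fm.holds_subst]
    convert hM A h
  | hyp h => exact hΓ _ h
  | negI _ _ ih₁ ih₂ =>
    intro hA
    have hΓ' := List.forall_mem_cons (p := Fm.holds M ρ).2 ⟨hA, hΓ⟩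
    exact ih₂ ρ hΓ' (ih₁ ρ hΓ')
  | @raa n Γ A B _ _ ih₁ ih₂ =>
    by_contra hA
    have hΓ' := List.forall_mem_cons (p := Fm.holds M ρ) (a := ∼A).2 ⟨hA, hΓ⟩
    exact ih₂ ρ hΓ' (ih₁ ρ hΓ')
  | andI _ _ ih₁ ih₂ => exact ⟨ih₁ ρ hΓ, ih₂ ρ hΓ⟩
  | andE₁ _ ih => exact (ih ρ hΓ).1
  | andE₂ _ ih => exact (ih ρ hΓ).2
  | impI _ ih => exact fun hA => ih ρ (List.forall_mem_cons (p := Fm.holds M ρ).2 ⟨hA, hΓ⟩)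
  | impE _ _ ih₁ ih₂ => exact ih₁ ρ hΓ (ih₂ ρ hΓ)
  | allI _ ih =>
    intro d
    refine ih (push ρ d) fun B hB => ?_
    obtain ⟨C, hC, rfl⟩ := List.mem_map.1 hB
    exact (Fm.holds_wk_one ρ d C).2 (hΓ C hC)
  | allE t _ ih => exact (Fm.holds_at_zero _ _ _).2 (ih ρ hΓ _)
  | eqRefl t => exact rfl
  | eqSubst A _ _ ih₁ ih₂ =>
    have h₁ := ih₁ ρ hΓ
    have h₂ := (Fm.holds_at_zero _ _ _).1 (ih₂ ρ hΓ)
    simp only [Fm.holds] at h₁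
    rw [h₁] at h₂
    exact (Fm.holds_at_zero _ _ _).2 h₂

end Semantics
/-! ### Completeness -/

section Calculus

variable {X : Type} {Y : ℕ → Type} {Th : Fm X Y 0 → Prop} {n : ℕ} {Γ : List (Fm X Y n)}
  {A B : Fm X Y n}

theorem Derives.mono {n : ℕ} {Γ Δ : List (Fm X Y n)} {A : Fm X Y n} (h : Derives Th Γ A)
    (hΓ : Γ ⊆ Δ) : Derives Th Δ A := by
  induction h with
  | ax h => exact .ax h
  | hyp h => exact .hyp (hΓ h)
  | negI _ _ ih₁ ih₂ =>
    exact .negI (ih₁ (List.cons_subset_cons _ hΓ)) (ih₂ (List.cons_subset_cons _ hΓ))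
  | raa _ _ ih₁ ih₂ =>
    exact .raa (ih₁ (List.cons_subset_cons _ hΓ)) (ih₂ (List.cons_subset_cons _ hΓ))
  | andI _ _ ih₁ ih₂ => exact .andI (ih₁ hΓ) (ih₂ hΓ)
  | andE₁ _ ih => exact .andE₁ (ih hΓ)
  | andE₂ _ ih => exact .andE₂ (ih hΓ)
  | impI _ ih => exact .impI (ih (List.cons_subset_cons _ hΓ))
  | impE _ _ ih₁ ih₂ => exact .impE (ih₁ hΓ) (ih₂ hΓ)
  | allI _ ih => exact .allI (ih (List.map_subset _ hΓ))
  | allE t _ ih => exact .allE t (ih hΓ)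
  | eqRefl t => exact .eqRefl t
  | eqSubst A _ _ ih₁ ih₂ => exact .eqSubst A (ih₁ hΓ) (ih₂ hΓ)

theorem Derives.cons (h : Derives Th Γ A) : Derives Th (B :: Γ) A :=
  h.mono (List.subset_cons_self B Γ)

theorem Derives.head : Derives Th (A :: Γ) A := .hyp List.mem_cons_self

theorem Derives.exfalso (h₁ : Derives Th Γ A) (h₂ : Derives Th Γ ∼A) : Derives Th Γ B :=
  .raa h₁.cons h₂.cons

theorem Derives.subst {n m : ℕ} {Γ : List (Fm X Y n)} {A : Fm X Y n} (h : Derives Th Γ A)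
    (σ : Fin n → Tm X m) : Derives Th (Γ.map (Fm.subst σ)) (A.subst σ) := by
  induction h generalizing m with
  | @ax n Γ A h =>
    rw [Fm.subst_subst]
    convert Derives.ax h
  | hyp h => exact .hyp (List.mem_map_of_mem h)
  | negI _ _ ih₁ ih₂ => exact .negI (ih₁ σ) (ih₂ σ)
  | raa _ _ ih₁ ih₂ => exact .raa (ih₁ σ) (ih₂ σ)
  | andI _ _ ih₁ ih₂ => exact .andI (ih₁ σ) (ih₂ σ)
  | andE₁ _ ih => exact .andE₁ (ih σ)
  | andE₂ _ ih => exact .andE₂ (ih σ)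
  | impI _ ih => exact .impI (ih σ)
  | impE _ _ ih₁ ih₂ => exact .impE (ih₁ σ) (ih₂ σ)
  | @allI n Γ A _ ih =>
    refine .allI ?_
    have := ih (liftSubst σ)
    simpa only [List.map_map, Function.comp_def, Fm.subst_wk] using this
  | allE t _ ih =>
    rw [Fm.subst_at]
    exact .allE _ (ih σ)
  | eqRefl t => exact .eqRefl _
  | eqSubst A _ _ ih₁ ih₂ =>
    have := ih₂ σ
    rw [Fm.subst_at] at this ⊢
    exact .eqSubst _ (ih₁ σ) this

theorem Derives.wk (h : Derives Th Γ A) : Derives Th (Γ.map (Fm.wk 1)) (A.wk 1) := h.subst _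

/-- The logic presupposes a nonempty domain: the closed term `k` can be put for the additional
variable, so enlarging the context is conservative. -/
theorem Derives.of_wk (h : Derives Th (Γ.map (Fm.wk 1)) (A.wk 1)) : Derives Th Γ A :=
  Fm.wk_at A (.base .k) ▸ h.allI.allE (.base .k)

/-- Replacement of equals, simultaneously for all variables of a formula. -/
theorem Derives.substCongr {m : ℕ} {Γ : List (Fm X Y m)} (A : Fm X Y n) {σ τ : Fin n → Tm X m}
    (h : ∀ i, Derives Th Γ (σ i ≐ τ i)) (hA : Derives Th Γ (A.subst σ)) :
    Derives Th Γ (A.subst τ) := by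
  classical
  -- `eqSubst` replaces a single variable. Here `s` is the set of variables already replaced, and it
  -- grows one element at a time up to all of them; `B` marks the next position by a fresh last
  -- variable.
  suffices H : ∀ s : Finset (Fin n),
      Derives Th Γ (A.subst fun i => if i ∈ s then τ i else σ i) by
    simpa using H Finset.univ
  intro s
  induction s using Finset.induction_on with
  | empty => simpa using hA
  | insert j s hj ih =>
    let B : Fm X Y (m + 1) := A.subst fun i =>
      if i = j then .var (Fin.last m) else (if i ∈ s then τ i else σ i).wk 1
    have hB : ∀ t, B.at (j := 0) t =
        A.subst fun i => if i = j then t else if i ∈ s then τ i else σ i := by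
      intro t
      simp only [B, Fm.at_eq_subst_push, Fm.subst_subst]
      congr 1
      funext i
      by_cases hi : i = j
      · simp [hi, Tm.subst]
      · simp only [hi, if_false, Tm.wk, Tm.subst_subst, Tm.subst, push_castAdd_one]
        exact Tm.subst_var _
    have h₁ : B.at (j := 0) (σ j) = A.subst fun i => if i ∈ s then τ i else σ i := by
      rw [hB]
      congr 1
      funext i
      by_cases hi : i = j
      · subst hi; simp [hj]
      · simp [hi]
    have h₂ : B.at (j := 0) (τ j) = A.subst fun i => if i ∈ insert j s then τ i else σ i := by
      rw [hB]
      congr 1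
      funext i
      by_cases hi : i = j
      · subst hi; simp
      · simp [hi]
    exact h₂ ▸ .eqSubst B (h j) (h₁ ▸ ih)

theorem Derives.eqSymm {a b : Tm X n} (h : Derives Th Γ (a ≐ b)) : Derives Th Γ (b ≐ a) :=
  Derives.substCongr (n := 2) (𝐱 0 ≐ 𝐱 1) (σ := ![a, a]) (τ := ![b, a])
    (Fin.forall_fin_two.2 ⟨h, .eqRefl a⟩) (.eqRefl a)

theorem Derives.eqTrans {a b c : Tm X n} (h₁ : Derives Th Γ (a ≐ b)) (h₂ : Derives Th Γ (b ≐ c)) :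
    Derives Th Γ (a ≐ c) :=
  Derives.substCongr (n := 2) (𝐱 0 ≐ 𝐱 1) (σ := ![a, b]) (τ := ![a, c])
    (Fin.forall_fin_two.2 ⟨.eqRefl a, h₂⟩) h₁

theorem Derives.eqApp {a b c d : Tm X n} (h₁ : Derives Th Γ (a ≐ b)) (h₂ : Derives Th Γ (c ≐ d)) :
    Derives Th Γ (a ⬝ c ≐ b ⬝ d) :=
  Derives.substCongr (n := 4) (𝐱 0 ⬝ 𝐱 1 ≐ 𝐱 2 ⬝ 𝐱 3) (σ := ![a, c, a, c]) (τ := ![a, c, b, d])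
    (by
      intro i
      fin_cases i
      exacts [.eqRefl a, .eqRefl c, h₁, h₂]) (.eqRefl (a ⬝ c))

/-- Every term denotes. -/
theorem Derives.exTerm (t : Tm X n) : Derives Th Γ ∼(∼(Fm.eq (.var (Fin.last n)) (t.wk 1))).all := by
  refine .negI (B := t ≐ t) (.eqRefl t) ?_
  have h : Derives Th ((∼(Fm.eq (.var (Fin.last n)) (t.wk 1))).all :: Γ) _ := Derives.head.allE t
  have e : (∼(Fm.eq (.var (Fin.last n)) (t.wk 1)) : Fm X Y (n + 1)).at (j := 0) t = ∼(t ≐ t) := by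
    simp only [Fm.at_eq_subst_push, Fm.subst, Tm.subst, push_last, Tm.wk, Tm.subst_subst,
      push_castAdd_one]
    simp [Tm.subst_var]
  exact e ▸ h

/-- `Γ` is consistent with `Th`. -/
def Consistent (Th : Fm X Y 0 → Prop) (Γ : List (Fm X Y n)) : Prop :=
  ∀ A, Derives Th Γ A → ¬Derives Th Γ ∼A

theorem Consistent.map_wk (h : Consistent Th Γ) : Consistent Th (Γ.map (Fm.wk 1)) :=
  fun _ h₁ h₂ =>
    h (.base .k ≐ .base .k) (h₁.exfalso (B := Fm.wk 1 (.base .k ≐ .base .k)) h₂).of_wk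
      (h₁.exfalso (B := Fm.wk 1 ∼(.base .k ≐ .base .k)) h₂).of_wk

/-- The Henkin axiom for the formula `A`, the new variable being the witness. -/
theorem Consistent.henkin (h : Consistent Th Γ) (A : Fm X Y (n + 1)) :
    Consistent Th ((A ➝ A.all.wk 1) :: Γ.map (Fm.wk 1)) := by
  intro B h₁ h₂
  have h₃ : Derives Th (Γ.map (Fm.wk 1)) ∼(A ➝ A.all.wk 1) := .negI h₁ h₂
  -- Refuting the Henkin axiom proves `A` of the new variable. The old assumptions do not mention
  -- that variable, so `A.all` follows, and with it the refuted implication.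
  have h₄ : Derives Th (Γ.map (Fm.wk 1)) A :=
    .raa (B := A ➝ A.all.wk 1) (.impI (Derives.head.exfalso Derives.head.cons)) h₃.cons
  exact h.map_wk _ (.impI h₄.allI.wk.cons) h₃

open Classical in
/-- One step of the Henkin construction: a Henkin axiom for `A` is added, and `B` is decided. -/
noncomputable def henkinStep (Th : Fm X Y 0 → Prop) {n : ℕ} (Γ : List (Fm X Y n)) (A B : Fm X Y (n + 1)) :
    List (Fm X Y (n + 1)) :=
  if Consistent Th (B :: (A ➝ A.all.wk 1) :: Γ.map (Fm.wk 1)) then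
    B :: (A ➝ A.all.wk 1) :: Γ.map (Fm.wk 1)
  else (A ➝ A.all.wk 1) :: Γ.map (Fm.wk 1)

theorem henkinStep_consistent (h : Consistent Th Γ) (A B : Fm X Y (n + 1)) :
    Consistent Th (henkinStep Th Γ A B) := by
  unfold henkinStep
  split_ifs with hB
  exacts [hB, h.henkin A]

theorem subset_henkinStep (A B : Fm X Y (n + 1)) :
    (A ➝ A.all.wk 1) :: Γ.map (Fm.wk 1) ⊆ henkinStep Th Γ A B := by
  unfold henkinStep
  split_ifs
  exacts [List.subset_cons_self _ _, List.Subset.refl _]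

theorem henkinStep_decides (A B : Fm X Y (n + 1)) :
    Derives Th (henkinStep Th Γ A B) B ∨ Derives Th (henkinStep Th Γ A B) ∼B := by
  unfold henkinStep
  split_ifs with hB
  · exact .inl .head
  · simp only [Consistent, not_forall, not_not] at hB
    obtain ⟨C, h₁, h₂⟩ := hB
    exact .inr (.negI h₁ h₂)

end Calculus

/-! ### Countability of the set of formulas. -/

section Countability

variable {X : Type} {Y : ℕ → Type}

/-- A numbering of terms, from one of the constants. -/
def Tm.code (f : X → ℕ) {n : ℕ} : Tm X n → ℕ
  | .var i => Nat.pair 0 i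
  | .base c => Nat.pair 1 c.ctorIdx
  | .ext c => Nat.pair 2 (f c)
  | .app a b => Nat.pair 3 (Nat.pair (a.code f) (b.code f))

theorem Tm.code_injective {f : X → ℕ} (hf : f.Injective) {n : ℕ} :
    (Tm.code f (n := n)).Injective := by
  intro a
  induction a with
  | var i =>
    intro b h
    cases b <;> simp [Tm.code, Nat.pair_eq_pair, Fin.ext_iff] at h ⊢
    exact h
  | base c =>
    intro b h
    cases b with
    | base d => cases c <;> cases d <;> simp [Tm.code, Nat.pair_eq_pair, BaseConst.ctorIdx] at h ⊢
    | _ => simp [Tm.code, Nat.pair_eq_pair] at h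
  | ext c =>
    intro b h
    cases b <;> simp [Tm.code, Nat.pair_eq_pair] at h ⊢
    exact hf h
  | app a a' ih ih' =>
    intro b h
    cases b <;> simp [Tm.code, Nat.pair_eq_pair] at h ⊢
    exact ⟨ih h.1, ih' h.2⟩

/-- A numbering of formulas, from one of the constants and one of the relation symbols. -/
def Fm.code (f : X → ℕ) (g : (Σ k, Y k) → ℕ) : {n : ℕ} → Fm X Y n → ℕ
  | _, .eq a b => Nat.pair 0 (Nat.pair (a.code f) (b.code f))
  | _, .nat a => Nat.pair 1 (a.code f)
  | _, .rel r ts =>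
    Nat.pair 2 (Nat.pair (g ⟨_, r⟩) (Encodable.encode (List.ofFn fun i => (ts i).code f)))
  | _, .neg A => Nat.pair 3 (A.code f g)
  | _, .and A B => Nat.pair 4 (Nat.pair (A.code f g) (B.code f g))
  | _, .imp A B => Nat.pair 5 (Nat.pair (A.code f g) (B.code f g))
  | _, .all A => Nat.pair 6 (A.code f g)

theorem Fm.code_injective {f : X → ℕ} (hf : f.Injective) {g : (Σ k, Y k) → ℕ} (hg : g.Injective)
    {n : ℕ} : (Fm.code f g (n := n)).Injective := by
  intro A
  induction A with
  | eq a b =>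
    intro B h
    cases B <;> simp [Fm.code, Nat.pair_eq_pair] at h ⊢
    exact ⟨Tm.code_injective hf h.1, Tm.code_injective hf h.2⟩
  | nat a =>
    intro B h
    cases B <;> simp [Fm.code, Nat.pair_eq_pair] at h ⊢
    exact Tm.code_injective hf h
  | rel r ts =>
    intro B h
    cases B with
    | rel r' ts' =>
      simp only [Fm.code, Nat.pair_eq_pair, true_and, Encodable.encode_inj] at h
      obtain ⟨h₁, h₂⟩ := h
      cases hg h₁
      rw [List.ofFn_inj] at h₂
      congr 1
      exact funext fun i => Tm.code_injective hf (congrFun h₂ i)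
    | _ => simp [Fm.code, Nat.pair_eq_pair] at h
  | neg A ih =>
    intro B h
    cases B <;> simp [Fm.code, Nat.pair_eq_pair] at h ⊢
    exact ih h
  | and A A' ih ih' =>
    intro B h
    cases B <;> simp [Fm.code, Nat.pair_eq_pair] at h ⊢
    exact ⟨ih h.1, ih' h.2⟩
  | imp A A' ih ih' =>
    intro B h
    cases B <;> simp [Fm.code, Nat.pair_eq_pair] at h ⊢
    exact ⟨ih h.1, ih' h.2⟩
  | all A ih =>
    intro B h
    cases B <;> simp [Fm.code, Nat.pair_eq_pair] at h ⊢
    exact ih h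

instance [Countable X] [∀ k, Countable (Y k)] (n : ℕ) : Countable (Fm X Y n) := by
  obtain ⟨f, hf⟩ := exists_injective_nat X
  obtain ⟨g, hg⟩ := exists_injective_nat (Σ k, Y k)
  exact (Fm.code_injective hf hg).countable

/-- A countable type can be enumerated with each element recurring. -/
theorem exists_recurring_enumeration (α : Type) [Countable α] [Nonempty α] :
    ∃ g : ℕ → α, ∀ a N, ∃ i, N ≤ i ∧ g i = a := by
  obtain ⟨e, he⟩ := exists_surjective_nat α
  refine ⟨fun i => e i.unpair.1, fun a N => ?_⟩
  obtain ⟨k, rfl⟩ := he a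
  exact ⟨Nat.pair k N, Nat.right_le_pair k N, by simp⟩

end Countability
-- Henkin sequences and the term model.
section Henkin

variable {X : Type} {Y : ℕ → Type}

/-- The variable `x_i`, as a term of context `m + 1`; meaningful if `i ≤ m`. -/
def hvar (X : Type) (m i : ℕ) : Tm X (m + 1) := .var (Fin.ofNat (m + 1) i)

/-- The substitution of the variables with numbers `ρ`, in context `m + 1`. -/
def hvars (X : Type) {n : ℕ} (m : ℕ) (ρ : Fin n → ℕ) : Fin n → Tm X (m + 1) :=
  fun j => hvar X m (ρ j)

theorem hvar_wk {m i : ℕ} (h : i ≤ m) : (hvar X m i).wk 1 = hvar X (m + 1) i := by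
  refine congrArg Tm.var (Fin.ext ?_)
  simp [Nat.mod_eq_of_lt (show i < m + 1 by omega), Nat.mod_eq_of_lt (show i < m + 1 + 1 by omega)]

theorem Fm.subst_hvars_wk {n m : ℕ} {ρ : Fin n → ℕ} (hρ : ∀ j, ρ j ≤ m) (A : Fm X Y n) :
    (A.subst (hvars X m ρ)).wk 1 = A.subst (hvars X (m + 1) ρ) := by
  simp only [Fm.wk, Fm.subst_subst]
  congr 1
  funext j
  exact hvar_wk (hρ j)

theorem liftSubst_hvars {n m : ℕ} {ρ : Fin n → ℕ} (hρ : ∀ j, ρ j ≤ m) :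
    liftSubst (hvars X m ρ) = hvars X (m + 1) (push ρ (m + 1)) := by
  funext j
  induction j using Fin.lastCases with
  | last =>
    rw [liftSubst_last]
    refine congrArg Tm.var (Fin.ext ?_)
    simp
  | cast j => simpa [hvars] using hvar_wk (hρ j)

theorem Fm.subst_liftSubst_at {n m : ℕ} (σ : Fin n → Tm X m) (t : Tm X m) (A : Fm X Y (n + 1)) :
    (A.subst (liftSubst σ)).at (j := 0) t = A.subst (push σ t) := by
  simp only [Fm.at_eq_subst_push, Fm.subst_subst]
  congr 1
  funext j
  induction j using Fin.lastCases with
  | last => simp [Tm.subst]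
  | cast j =>
    simp only [liftSubst_castSucc, push_castSucc, Tm.wk, Tm.subst_subst, Tm.subst,
      push_castAdd_one]
    exact Tm.subst_var _

theorem hvars_push {n m : ℕ} (ρ : Fin n → ℕ) (k : ℕ) :
    hvars X m (push ρ k) = push (hvars X m ρ) (hvar X m k) := comp_push (hvar X m) ρ k

theorem Fm.wk_subst_push {n m : ℕ} (σ : Fin n → Tm X m) (t : Tm X m) (A : Fm X Y n) :
    (A.wk 1).subst (push σ t) = A.subst σ := by
  simp only [Fm.wk, Fm.subst_subst, Tm.subst, push_castAdd_one]

theorem Tm.wk_subst_push {n m : ℕ} (σ : Fin n → Tm X m) (t : Tm X m) (a : Tm X n) :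
    (a.wk 1).subst (push σ t) = a.subst σ := by
  simp only [Tm.wk, Tm.subst_subst, Tm.subst, push_castAdd_one]

/-- An increasing sequence of consistent sets of assumptions, in growing contexts, that decides
every formula and has witnesses for every universal formula. -/
structure HenkinSeq (Th : Fm X Y 0 → Prop) where
  /-- The assumptions. -/
  Γ : ∀ m, List (Fm X Y (m + 1))
  consistent : ∀ m, Consistent Th (Γ m)
  mono : ∀ m, (Γ m).map (Fm.wk 1) ⊆ Γ (m + 1)
  -- The bound `N` is essential: `hvar` reduces variable numbers modulo `m + 1`, so the instance at
  -- `ρ` is the intended one only when `m` is at least every value of `ρ`.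
  henkin : ∀ {n} (A : Fm X Y (n + 1)) (ρ : Fin n → ℕ) (N : ℕ), ∃ m, N ≤ m ∧
    Derives Th (Γ (m + 1)) (A.subst (liftSubst (hvars X m ρ)) ➝ (A.all.subst (hvars X m ρ)).wk 1)
  decides : ∀ {n} (A : Fm X Y n) (ρ : Fin n → ℕ) (N : ℕ), ∃ m, N ≤ m ∧
    (Derives Th (Γ m) (A.subst (hvars X m ρ)) ∨ Derives Th (Γ m) ∼(A.subst (hvars X m ρ)))

theorem HenkinSeq.exists_of_consistent [Countable X] [∀ k, Countable (Y k)]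
    {Th : Fm X Y 0 → Prop} {Δ : List (Fm X Y 1)} (hΔ : Consistent Th Δ) :
    ∃ G : HenkinSeq Th, G.Γ 0 = Δ := by
  have : Nonempty (Fm X Y 1) := ⟨.nat (𝐱 0)⟩
  have : Nonempty (Fm X Y 0) := ⟨.nat (.base .k)⟩
  have : Nonempty (Σ n, Fm X Y (n + 1) × (Fin n → ℕ)) := ⟨0, Classical.arbitrary _, Fin.elim0⟩
  have : Nonempty (Σ n, Fm X Y n × (Fin n → ℕ)) := ⟨0, Classical.arbitrary _, Fin.elim0⟩
  -- One enumeration serves both tasks: first components receive a witness, second components are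
  -- decided. Recurrence lets each be treated at a stage late enough for its variables to exist.
  obtain ⟨g, hg⟩ := exists_recurring_enumeration
    ((Σ n, Fm X Y (n + 1) × (Fin n → ℕ)) × (Σ n, Fm X Y n × (Fin n → ℕ)))
  let Γ : ∀ m, List (Fm X Y (m + 1)) := fun m => Nat.rec (motive := fun m => List (Fm X Y (m + 1)))
    Δ (fun m Γ => henkinStep Th Γ ((g m).1.2.1.subst (liftSubst (hvars X m (g m).1.2.2)))
      ((g m).2.2.1.subst (hvars X (m + 1) (g m).2.2.2))) m
  refine ⟨⟨Γ, fun m => ?_, fun m => ?_, fun {n} A ρ N => ?_, fun {n} A ρ N => ?_⟩, rfl⟩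
  · induction m with
    | zero => exact hΔ
    | succ m ih => exact henkinStep_consistent ih _ _
  · exact List.Subset.trans (List.subset_cons_self _ _) (subset_henkinStep _ _)
  · obtain ⟨m, hm, e⟩ := hg (⟨n, A, ρ⟩, Classical.arbitrary _) N
    refine ⟨m, hm, .hyp ?_⟩
    have h := subset_henkinStep (Th := Th) (Γ := Γ m)
      ((g m).1.2.1.subst (liftSubst (hvars X m (g m).1.2.2)))
      ((g m).2.2.1.subst (hvars X (m + 1) (g m).2.2.2)) List.mem_cons_self
    change _ ∈ Γ (m + 1) at h
    rw [e] at h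
    exact h
  · obtain ⟨m, hm, e⟩ := hg (Classical.arbitrary _, ⟨n, A, ρ⟩) N
    -- Step `m` decides its formula inside `Γ (m + 1)`, read with the variables of that larger
    -- context.
    refine ⟨m + 1, hm.trans m.le_succ, ?_⟩
    have h := henkinStep_decides (Th := Th) (Γ := Γ m)
      ((g m).1.2.1.subst (liftSubst (hvars X m (g m).1.2.2)))
      ((g m).2.2.1.subst (hvars X (m + 1) (g m).2.2.2))
    change Derives Th (Γ (m + 1)) _ ∨ Derives Th (Γ (m + 1)) _ at h
    rw [e] at h
    exact h

namespace HenkinSeq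

open Filter

variable {Th : Fm X Y 0 → Prop} (G : HenkinSeq Th) {n : ℕ}

/-- The formula `A`, read at the variables with numbers `ρ`, is eventually derivable. -/
def Forces (A : Fm X Y n) (ρ : Fin n → ℕ) : Prop :=
  ∀ᶠ m in atTop, Derives Th (G.Γ m) (A.subst (hvars X m ρ))

theorem exists_bound (ρ : Fin n → ℕ) : ∃ N, ∀ j, ρ j ≤ N :=
  ⟨Finset.univ.sup ρ, fun j => Finset.le_sup (Finset.mem_univ j)⟩

variable {G}

theorem forces_of_derives {A : Fm X Y n} {ρ : Fin n → ℕ} {m : ℕ} (hρ : ∀ j, ρ j ≤ m)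
    (h : Derives Th (G.Γ m) (A.subst (hvars X m ρ))) : G.Forces A ρ := by
  refine eventually_atTop.2 ⟨m, fun k hk => ?_⟩
  induction k, hk using Nat.le_induction with
  | base => exact h
  | succ k hk ih =>
    rw [← Fm.subst_hvars_wk fun j => (hρ j).trans hk]
    exact ih.wk.mono (G.mono k)

/-- Consistency gives one direction. For the other, `A` is decided at some late stage, and what is
derived there persists. -/
theorem forces_neg {A : Fm X Y n} {ρ : Fin n → ℕ} : G.Forces ∼A ρ ↔ ¬G.Forces A ρ := by
  constructor
  · intro h₁ h₂
    obtain ⟨m, h₁, h₂⟩ := (h₁.and h₂).exists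
    exact G.consistent m _ h₂ h₁
  · intro h
    obtain ⟨N, hN⟩ := exists_bound ρ
    obtain ⟨m, hm, h₁ | h₁⟩ := G.decides A ρ N
    · exact absurd (forces_of_derives (fun j => (hN j).trans hm) h₁) h
    · exact forces_of_derives (A := ∼A) (fun j => (hN j).trans hm) h₁

theorem forces_and {A B : Fm X Y n} {ρ : Fin n → ℕ} :
    G.Forces (A ⋏ B) ρ ↔ G.Forces A ρ ∧ G.Forces B ρ :=
  ⟨fun h => ⟨h.mono fun _ h => h.andE₁, h.mono fun _ h => h.andE₂⟩,
    fun h => (h.1.and h.2).mono fun _ h => .andI h.1 h.2⟩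

theorem forces_imp {A B : Fm X Y n} {ρ : Fin n → ℕ} :
    G.Forces (A ➝ B) ρ ↔ (G.Forces A ρ → G.Forces B ρ) := by
  refine ⟨fun h hA => (h.and hA).mono fun _ h => .impE h.1 h.2, fun h => ?_⟩
  by_cases hA : G.Forces A ρ
  · exact (h hA).mono fun _ h => .impI h.cons
  · exact (forces_neg.2 hA).mono fun _ h => .impI (Derives.head.exfalso h.cons)

theorem forces_all {A : Fm X Y (n + 1)} {ρ : Fin n → ℕ} :
    G.Forces A.all ρ ↔ ∀ k, G.Forces A (push ρ k) := by
  constructor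
  · intro h k
    refine h.mono fun m h => ?_
    rw [hvars_push, ← Fm.subst_liftSubst_at]
    exact h.allE _
  · intro h
    obtain ⟨N, hN⟩ := exists_bound ρ
    obtain ⟨m, hm, h₁⟩ := G.henkin A ρ N
    have hρ : ∀ j, ρ j ≤ m := fun j => (hN j).trans hm
    -- The witness is the variable number `m + 1`, which is new at stage `m + 1`.
    have h₂ : G.Forces (A ➝ A.all.wk 1) (push ρ (m + 1)) := by
      refine forces_of_derives (m := m + 1) (fun j => ?_) ?_
      · induction j using Fin.lastCases with
        | last => simp
        | cast j => simpa using (hρ j).trans m.le_succ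
      · change Derives Th _ (_ ➝ (A.all.wk 1).subst _)
        rw [hvars_push (k := m + 1), Fm.wk_subst_push, ← hvars_push, ← liftSubst_hvars hρ,
          ← Fm.subst_hvars_wk hρ]
        exact h₁
    refine (forces_imp.1 h₂ (h _)).mono fun k h => ?_
    rwa [hvars_push, Fm.wk_subst_push] at h

theorem forces_of_theorem {A : Fm X Y n} (h : Derives Th [] A) (ρ : Fin n → ℕ) : G.Forces A ρ :=
  .of_forall fun m => (h.subst (hvars X m ρ)).mono (List.nil_subset _)

variable (G) in
/-- The variable with number `k` is a value of the term `t` at the variables with numbers `ρ`. -/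
def IsValue (t : Tm X n) (ρ : Fin n → ℕ) (k : ℕ) : Prop :=
  ∀ᶠ m in atTop, Derives Th (G.Γ m) (hvar X m k ≐ t.subst (hvars X m ρ))

-- If no variable had the value of `t`, then "every object differs from `t`" would be forced,
-- against `Derives.exTerm`. Hence variable numbers alone can serve as the domain of the term model.
variable (G) in
theorem exists_isValue (t : Tm X n) (ρ : Fin n → ℕ) : ∃ k, G.IsValue t ρ k := by
  by_contra! h
  have h₁ := forces_of_theorem (G := G) (Derives.exTerm t) ρ
  refine forces_neg.1 h₁ (forces_all.2 fun k => forces_neg.2 fun hk => h k (hk.mono fun m hm => ?_))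
  simp only [Fm.subst, hvars_push, Tm.wk_subst_push, Tm.subst, push_last] at hm
  exact hm

theorem forces_subst {m : ℕ} {A : Fm X Y n} {σ : Fin n → Tm X m} {ρ : Fin m → ℕ} {κ : Fin n → ℕ}
    (h : ∀ i, G.IsValue (σ i) ρ (κ i)) : G.Forces (A.subst σ) ρ ↔ G.Forces A κ := by
  have h' := eventually_all.2 h
  constructor
  · intro hA
    refine (h'.and hA).mono fun m hm => ?_
    rw [Fm.subst_subst] at hm
    exact .substCongr A (fun i => (hm.1 i).eqSymm) hm.2
  · intro hA
    refine (h'.and hA).mono fun m hm => ?_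
    rw [Fm.subst_subst]
    exact .substCongr A hm.1 hm.2

variable (G) in
/-- Eventually derivable equality of variables. -/
def setoid : Setoid ℕ where
  r i j := ∀ᶠ m in atTop, Derives Th (G.Γ m) (hvar X m i ≐ hvar X m j)
  iseqv := ⟨fun _ => .of_forall fun _ => .eqRefl _, fun h => h.mono fun _ h => h.eqSymm,
    fun h₁ h₂ => (h₁.and h₂).mono fun _ h => h.1.eqTrans h.2⟩

variable (G) in
/-- The term model of a Henkin sequence. -/
noncomputable def model : Model X Y where
  D := Quotient G.setoid
  base c := Quotient.mk _ (G.exists_isValue (n := 0) (.base c) Fin.elim0).choose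
  ext c := Quotient.mk _ (G.exists_isValue (n := 0) (.ext c) Fin.elim0).choose
  app d e := Quotient.mk _ (G.exists_isValue (𝐱 0 ⬝ 𝐱 1) ![d.out, e.out]).choose
  nat d := G.Forces (.nat (𝐱 0)) ![d.out]
  rel r v := G.Forces (.rel r Tm.var) fun i => (v i).out

/-- The term model interprets application and relations at chosen representatives; this moves a
value to the representative of its class. -/
theorem isValue_out {t : Tm X n} {ρ : Fin n → ℕ} {k : ℕ} (h : G.IsValue t ρ k) :
    G.IsValue t ρ (Quotient.mk G.setoid k).out :=
  (h.and (Quotient.mk_out (s := G.setoid) k : _)).mono fun _ h => h.2.eqTrans h.1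

theorem eval_model (t : Tm X n) (ρ : Fin n → ℕ) :
    ∀ k, G.IsValue t ρ k → t.eval G.model (fun i => Quotient.mk G.setoid (ρ i)) =
      Quotient.mk G.setoid k := by
  induction t with
  | var i => exact fun k hk => Quotient.sound (hk.mono fun _ h => h.eqSymm)
  | base c =>
    intro k hk
    refine Quotient.sound (s := G.setoid) ?_
    exact (hk.and (G.exists_isValue (n := 0) (.base c) Fin.elim0).choose_spec).mono fun m h =>
      h.2.eqTrans h.1.eqSymm
  | ext c =>
    intro k hk
    refine Quotient.sound (s := G.setoid) ?_
    exact (hk.and (G.exists_isValue (n := 0) (.ext c) Fin.elim0).choose_spec).mono fun m h =>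
      h.2.eqTrans h.1.eqSymm
  | app a b iha ihb =>
    intro k hk
    obtain ⟨i, hi⟩ := G.exists_isValue a ρ
    obtain ⟨j, hj⟩ := G.exists_isValue b ρ
    simp only [Tm.eval, iha i hi, ihb j hj]
    refine Quotient.sound (s := G.setoid) ?_
    exact (((G.exists_isValue (𝐱 0 ⬝ 𝐱 1) _).choose_spec.and hk).and
      ((isValue_out hi).and (isValue_out hj))).mono fun m h =>
        h.1.1.eqTrans ((h.2.1.eqApp h.2.2).eqTrans h.1.2.eqSymm)

theorem holds_model (A : Fm X Y n) (ρ : Fin n → ℕ) :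
    A.holds G.model (fun i => Quotient.mk G.setoid (ρ i)) ↔ G.Forces A ρ := by
  induction A with
  | eq a b =>
    obtain ⟨i, hi⟩ := G.exists_isValue a ρ
    obtain ⟨j, hj⟩ := G.exists_isValue b ρ
    simp only [Fm.holds, eval_model a ρ i hi, eval_model b ρ j hj]
    refine (Quotient.eq (r := G.setoid)).trans ⟨fun h => ?_, fun h => ?_⟩
    · exact (h.and (hi.and hj)).mono fun m h => (h.2.1.eqSymm.eqTrans h.1).eqTrans h.2.2
    · exact (h.and (hi.and hj)).mono fun m h => (h.2.1.eqTrans h.1).eqTrans h.2.2.eqSymm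
  | nat a =>
    obtain ⟨i, hi⟩ := G.exists_isValue a ρ
    simp only [Fm.holds, eval_model a ρ i hi]
    exact (forces_subst (A := .nat (𝐱 0)) (σ := ![a])
      (κ := ![(Quotient.mk G.setoid i).out]) (Fin.forall_fin_one.2 (isValue_out hi))).symm
  | rel r ts =>
    choose κ hκ using fun i => G.exists_isValue (ts i) ρ
    simp only [Fm.holds, fun i => eval_model (ts i) ρ (κ i) (hκ i)]
    exact (forces_subst (A := .rel r Tm.var) (σ := ts)
      (κ := fun i => (Quotient.mk G.setoid (κ i)).out) fun i => isValue_out (hκ i)).symm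
  | neg A ih => rw [forces_neg, ← ih]; rfl
  | and A B ihA ihB => rw [forces_and, ← ihA, ← ihB]; rfl
  | imp A B ihA ihB => rw [forces_imp, ← ihA, ← ihB]; rfl
  | all A ih =>
    rw [forces_all]
    refine (Quotient.mk_surjective (s := G.setoid)).forall.trans (forall_congr' fun k => ?_)
    rw [← ih, comp_push]
    exact Iff.rfl

end HenkinSeq

/-- Gödel's completeness theorem, for countable languages. -/
theorem provable_of_holds [Countable X] [∀ k, Countable (Y k)] {Th : Fm X Y 0 → Prop}
    {A : Fm X Y 0} (h : ∀ M : Model X Y, M.Models Th → A.holds M Fin.elim0) : Provable Th A := by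
  by_contra hA
  have hc : Consistent Th [∼A] := fun B h₁ h₂ => hA (.raa h₁ h₂)
  -- Stage 0 of a Henkin sequence has one free variable, so the sentence is first weakened to
  -- context 1.
  obtain ⟨G, hG⟩ := HenkinSeq.exists_of_consistent hc.map_wk
  have e : (fun i => Quotient.mk G.setoid ((Fin.elim0 : Fin 0 → ℕ) i)) =
      (Fin.elim0 : Fin 0 → G.model.D) := funext fun i => i.elim0
  have hM : G.model.Models Th := fun B hB => by
    rw [← e, HenkinSeq.holds_model]
    refine HenkinSeq.forces_of_theorem ?_ _
    have := Derives.ax (Γ := []) (n := 0) hB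
    rwa [Subsingleton.elim (fun i : Fin 0 => i.elim0) Tm.var, Fm.subst_var] at this
  have h₁ := h G.model hM
  rw [← e, HenkinSeq.holds_model] at h₁
  refine HenkinSeq.forces_neg.1 (HenkinSeq.forces_of_derives (m := 0) (fun j => j.elim0) ?_) h₁
  rw [hG, Subsingleton.elim (hvars X 0 _) fun i : Fin 0 => Tm.var (Fin.castAdd 1 i)]
  exact .head

end Henkin
/-! ### Evaluation of the schemata and of the combinatory terms -/

section Append

variable {X : Type} {Y : ℕ → Type} {M : Model X Y} {m j : ℕ}

/-- Below, assignments for schemata are split into the parameters `ρ` and a vector `v` of additional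
variables, so that `pv m i` evaluates to `v i`. -/
theorem push_append {D : Type} (ρ : Fin m → D) (v : Fin j → D) (d : D) :
    push (Fin.append ρ v) d = (Fin.append ρ (push v d) : Fin (m + (j + 1)) → D) :=
  (Fin.append_snoc ρ v d).symm

theorem push_eq_append {D : Type} (ρ : Fin m → D) (d : D) : push ρ d = Fin.append ρ ![d] := by
  funext i
  induction i using Fin.lastCases with
  | last => exact (push_last ρ d).trans (Fin.append_right ρ ![d] 0).symm
  | cast i => exact (push_castSucc ρ d i).trans (Fin.append_left ρ ![d] i).symm

theorem push_cons_one {D : Type} (a b : D) : push ![a] b = ![a, b] := by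
  funext i; fin_cases i <;> rfl

theorem push_cons_two {D : Type} (a b c : D) : push ![a, b] c = ![a, b, c] := by
  funext i; fin_cases i <;> rfl

theorem push_cons_three {D : Type} (a b c d : D) : push ![a, b, c] d = ![a, b, c, d] := by
  funext i; fin_cases i <;> rfl

theorem push_cons_four {D : Type} (a b c d e : D) :
    push ![a, b, c, d] e = ![a, b, c, d, e] := by
  funext i; fin_cases i <;> rfl

theorem Tm.eval_pv (ρ : Fin m → M.D) (v : Fin j → M.D) (i : Fin j) :
    (pv m i : Tm X (m + j)).eval M (Fin.append ρ v) = v i := Fin.append_right ρ v i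

theorem Tm.eval_wk_append (ρ : Fin m → M.D) (v : Fin j → M.D) (t : Tm X m) :
    (t.wk j).eval M (Fin.append ρ v) = t.eval M ρ := by
  simp only [Tm.eval_wk, Fin.append_left]

theorem Fm.holds_at_append (A : Fm X Y (m + 1)) (t : Tm X (m + j)) (ρ : Fin m → M.D)
    (v : Fin j → M.D) :
    (A.at t).holds M (Fin.append ρ v) ↔ A.holds M (push ρ (t.eval M (Fin.append ρ v))) := by
  simp only [Fm.holds_at, Fin.append_left]

theorem exists_append {D : Type} (ρ : Fin (m + j) → D) :
    ∃ (ρ' : Fin m → D) (v : Fin j → D), ρ = Fin.append ρ' v :=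
  ⟨_, _, Fin.append_castAdd_natAdd.symm⟩

end Append

namespace Model

variable {X : Type} {Y : ℕ → Type} (M : Model X Y)

/-- The pairing operation of `M`. -/
def pair (a b : M.D) : M.D := M.app (M.app (M.base .p) a) b

/-- The first projection. -/
def fst (a : M.D) : M.D := M.app (M.base .p0) a

/-- The second projection. -/
def snd (a : M.D) : M.D := M.app (M.base .p1) a

/-- The denotation of `0`. -/
def zero : M.D := M.base .zero

/-- The successor operation. -/
def suc (a : M.D) : M.D := M.app (M.base .sN) a

/-- The content of the axioms of `TON`, for a structure. -/
structure IsTON : Prop where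
  k (a b : M.D) : M.app (M.app (M.base .k) a) b = a
  s (a b c : M.D) : M.app (M.app (M.app (M.base .s) a) b) c = M.app (M.app a c) (M.app b c)
  fst_pair (a b : M.D) : M.fst (M.pair a b) = a
  snd_pair (a b : M.D) : M.snd (M.pair a b) = b
  nat_zero : M.nat M.zero
  nat_suc (a : M.D) : M.nat a → M.nat (M.suc a)
  suc_ne (a : M.D) : M.nat a → M.suc a ≠ M.zero
  pred_suc (a : M.D) : M.nat a → M.app (M.base .pN) (M.suc a) = a
  nat_pred (a : M.D) : M.nat a → a ≠ M.zero → M.nat (M.app (M.base .pN) a)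
  suc_pred (a : M.D) : M.nat a → a ≠ M.zero → M.suc (M.app (M.base .pN) a) = a
  cases_eq (a b u v : M.D) : M.nat a → M.nat b → a = b →
    M.app (M.app (M.app (M.app (M.base .dN) u) v) a) b = u
  cases_ne (a b u v : M.D) : M.nat a → M.nat b → a ≠ b →
    M.app (M.app (M.app (M.app (M.base .dN) u) v) a) b = v
  induction {m : ℕ} (A : Fm X Y (m + 1)) (ρ : Fin m → M.D) : A.holds M (push ρ M.zero) →
    (∀ x, M.nat x → A.holds M (push ρ x) → A.holds M (push ρ (M.suc x))) →
    ∀ x, M.nat x → A.holds M (push ρ x)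

variable {M}

theorem holds_induction {m : ℕ} (A : Fm X Y (m + 1)) (ρ : Fin m → M.D) :
    (A.at (j := 0) FregeStructure.zero ⋏
      .all (.nat (pv m (j := 1) 0) ⋏ A ➝ A.at (FregeStructure.suc (pv m (j := 1) 0))) ➝
        .all (.nat (pv m (j := 1) 0) ➝ A)).holds M ρ ↔
    (A.holds M (push ρ M.zero) →
      (∀ x, M.nat x → A.holds M (push ρ x) → A.holds M (push ρ (M.suc x))) →
      ∀ x, M.nat x → A.holds M (push ρ x)) := by
  have h (x : M.D) : (A.at (FregeStructure.suc (pv m (j := 1) 0))).holds M (push ρ x) ↔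
      A.holds M (push ρ (M.suc x)) := by
    rw [push_eq_append ρ x, Fm.holds_at_append]
    exact iff_of_eq (congrArg (fun d => A.holds M (push ρ (M.suc d)))
      (Tm.eval_pv (X := X) (Y := Y) (M := M) ρ ![x] 0))
  have h' (x : M.D) : (pv m (j := 1) 0 : Tm X (m + 1)).eval M (push ρ x) = x := by
    rw [push_eq_append ρ x]
    exact Tm.eval_pv ρ ![x] 0
  simp only [Fm.holds, h, h', Fm.holds_at_zero, and_imp]
  rfl

theorem isTON_of_models (h : M.Models TON) : M.IsTON where
  k a b := (Fm.holds_closure _ _).1 (h _ .k) ![a, b]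
  s a b c := (Fm.holds_closure _ _).1 (h _ .s) ![a, b, c]
  fst_pair a b := ((Fm.holds_closure _ _).1 (h _ .pairing) ![a, b]).1
  snd_pair a b := ((Fm.holds_closure _ _).1 (h _ .pairing) ![a, b]).2
  nat_zero := (h _ .nat).1
  nat_suc := (h _ .nat).2
  suc_ne a ha := (h _ .suc a ha).1
  pred_suc a ha := (h _ .suc a ha).2
  nat_pred a ha h₀ := (h _ .pred a ⟨ha, h₀⟩).1
  suc_pred a ha h₀ := (h _ .pred a ⟨ha, h₀⟩).2
  cases_eq a b u v ha hb hab := (Fm.holds_closure _ _).1 (h _ .cases_eq) ![a, b, u, v] ⟨ha, hb, hab⟩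
  cases_ne a b u v ha hb hab := (Fm.holds_closure _ _).1 (h _ .cases_ne) ![a, b, u, v] ⟨ha, hb, hab⟩
  induction A ρ := (holds_induction A ρ).1 ((Fm.holds_closure _ _).1 (h _ (.induction A)) ρ)

theorem IsTON.models (h : M.IsTON) : M.Models TON := by
  intro A hA
  cases hA with
  | k => exact (Fm.holds_closure _ _).2 fun ρ => h.k _ _
  | s => exact (Fm.holds_closure _ _).2 fun ρ => h.s _ _ _
  | pairing => exact (Fm.holds_closure _ _).2 fun ρ => ⟨h.fst_pair _ _, h.snd_pair _ _⟩
  | nat => exact ⟨h.nat_zero, h.nat_suc⟩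
  | suc => exact fun a ha => ⟨h.suc_ne a ha, h.pred_suc a ha⟩
  | pred => exact fun a ha => ⟨h.nat_pred a ha.1 ha.2, h.suc_pred a ha.1 ha.2⟩
  | cases_eq => exact (Fm.holds_closure _ _).2 fun ρ hρ => h.cases_eq _ _ _ _ hρ.1 hρ.2.1 hρ.2.2
  | cases_ne => exact (Fm.holds_closure _ _).2 fun ρ hρ => h.cases_ne _ _ _ _ hρ.1 hρ.2.1 hρ.2.2
  | induction A =>
    exact (Fm.holds_closure _ _).2 fun ρ => (holds_induction A ρ).2 (h.induction A ρ)

/-- This is the β-law, an equality in every model of TON. There is no ξ-rule: abstracts with the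
same values may denote different objects. -/
theorem IsTON.eval_lam (h : M.IsTON) {n : ℕ} (t : Tm X (n + 1)) (ρ : Fin n → M.D) (d : M.D) :
    M.app ((lam t).eval M ρ) d = t.eval M (push ρ d) := by
  induction t using lam.induct with
  | case1 i =>
    induction i using Fin.lastCases with
    | last => simp [lam, Tm.eval, h.s, h.k]
    | cast i => simp [lam, Tm.eval, h.k]
  | case2 c => simp [lam, Tm.eval, h.k]
  | case3 c => simp [lam, Tm.eval, h.k]
  | case4 a b iha ihb => simp only [lam, Tm.eval, h.s, iha, ihb]

theorem IsTON.eval_recTm (h : M.IsTON) (f : M.D) {n : ℕ} (ρ : Fin n → M.D) :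
    M.app ((recTm.lift n : Tm X n).eval M ρ) f =
      M.app f (M.app ((recTm.lift n : Tm X n).eval M ρ) f) := by
  have e : M.app ((recTm.lift n : Tm X n).eval M ρ) f =
      M.app ((lam (𝐱 0 ⬝ (𝐱 1 ⬝ 𝐱 1)) : Tm X 1).eval M ![f])
        ((lam (𝐱 0 ⬝ (𝐱 1 ⬝ 𝐱 1)) : Tm X 1).eval M ![f]) := by
    rw [Tm.eval_lift, recTm, h.eval_lam]
    simp only [Tm.eval]
    congr 2 <;> exact funext fun i => by fin_cases i; rfl
  rw [e]
  -- With $\omega=\lambda x.\,f(xx)$, only the outer $\omega$ of $\omega\omega$ is unfolded, which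
  -- leaves $f(\omega\omega)$.
  nth_rw 1 [h.eval_lam]
  rfl

end Model

/-! ### Abstraction under renaming. -/

section Renaming

variable {X : Type}

/-- Only renamings are allowed here: `lam` sends an old variable to `k` applied to it but
distributes over applications, so it does not commute with substituting compound terms. -/
theorem lam_subst_var {n m : ℕ} (f : Fin n → Fin m) (t : Tm X (n + 1)) :
    (lam t).subst (fun i => .var (f i)) = lam (t.subst (liftSubst fun i => .var (f i))) := by
  induction t using lam.induct with
  | case1 i =>
    induction i using Fin.lastCases with
    | last => simp [lam, Tm.subst]
    | cast i =>
      have : (Tm.wk 1 (.var (f i)) : Tm X (m + 1)) = .var (f i).castSucc := rfl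
      simp [lam, Tm.subst, this]
  | case2 c => rfl
  | case3 c => rfl
  | case4 a b iha ihb => simp only [lam, Tm.subst, iha, ihb]

theorem Tm.wk_subst_liftSubst {n m : ℕ} (σ : Fin n → Tm X m) (t : Tm X n) :
    (t.wk 1).subst (liftSubst σ) = (t.subst σ).wk 1 := by
  simp only [Tm.wk, Tm.subst_subst, Tm.subst]
  congr 1
  funext i
  exact liftSubst_castSucc σ i

/-- The identity is one of terms, not merely of their values on arguments. Models need not be
extensional, and $\mathsf l(\oplus(u,v))$ must refer to the same object $\oplus(u,v)$ throughout. -/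
theorem oplus_wk {n : ℕ} (j : ℕ) (u v : FSTm n) : oplus (u.wk j) (v.wk j) = (oplus u v).wk j := by
  have h : (pv n (j := 1) 0 : FSTm (n + 1)).subst (liftSubst fun i => .var (Fin.castAdd j i)) =
      pv (n + j) (j := 1) 0 := liftSubst_last _
  refine Eq.trans ?_ (lam_subst_var _ _).symm
  simp only [oplus, dOr, dNeg, dAnd, dEq, pair, fst, snd, zero, Tm.subst, h, Tm.wk_subst_liftSubst]
  rfl

end Renaming
/-! ### Models of `KFUPI` -/

namespace Model

section FS

variable (M : Model FSConst FSRel)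

/-- The extension of `T`. -/
def T (a : M.D) : Prop := M.rel FSRel.T fun _ => a

/-- The extension of `U`. -/
def U (a : M.D) : Prop := M.rel FSRel.U fun _ => a

/-- The operation `=̇`. -/
def dEq (a b : M.D) : M.D := M.app (M.ext .eq) (M.pair a b)

/-- The operation `¬̇`. -/
def dNeg (a : M.D) : M.D := M.app (M.ext .neg) a

/-- The operation `∧̇`. -/
def dAnd (a b : M.D) : M.D := M.app (M.ext .and) (M.pair a b)

/-- The operation `→̇`. -/
def dImp (a b : M.D) : M.D := M.app (M.ext .imp) (M.pair a b)

/-- The operation `∀̇`. -/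
def dAll (f : M.D) : M.D := M.app (M.ext .all) f

/-- The operation `Ṅ`. -/
def dNat (a : M.D) : M.D := M.app (M.ext .nat) a

/-- The operation `∨̇`. -/
def dOr (a b : M.D) : M.D := M.dNeg (M.dAnd (M.dNeg a) (M.dNeg b))

/-- The operation `l`. -/
def lim (f : M.D) : M.D := M.app (M.ext .lim) f

/-- The propositions of `M`. -/
def P (a : M.D) : Prop := M.T a ∨ M.T (M.dNeg a)

/-- The classes of `M`. -/
def C (f : M.D) : Prop := ∀ x, M.P (M.app f x)

variable {M} {n : ℕ} {ρ : Fin n → M.D}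

theorem holds_tr (a : FSTm n) : (tr a).holds M ρ ↔ M.T (a.eval M ρ) :=
  iff_of_eq (congrArg (M.rel FSRel.T) (funext fun i => by fin_cases i; rfl))

theorem holds_un (a : FSTm n) : (un a).holds M ρ ↔ M.U (a.eval M ρ) :=
  iff_of_eq (congrArg (M.rel FSRel.U) (funext fun i => by fin_cases i; rfl))

theorem eval_pv_one (d : M.D) : (pv n (j := 1) 0 : FSTm (n + 1)).eval M (push ρ d) = d :=
  push_last ρ d

theorem holds_isProp (a : FSTm n) : (isProp a).holds M ρ ↔ M.P (a.eval M ρ) := by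
  simp only [isProp, Fm.holds_or, holds_tr]
  rfl

theorem holds_isClass (f : FSTm n) : (isClass f).holds M ρ ↔ M.C (f.eval M ρ) := by
  simp only [isClass, Fm.holds, holds_isProp, Tm.eval, Tm.eval_wk_one, eval_pv_one]
  rfl

/-- The compositional and consistency axioms, for the truth predicate `S`. -/
structure IsTruth (M : Model FSConst FSRel) (S : M.D → Prop) : Prop where
  eq (a b : M.D) : S (M.dEq a b) ↔ a = b
  ne (a b : M.D) : S (M.dNeg (M.dEq a b)) ↔ a ≠ b
  nat (a : M.D) : S (M.dNat a) ↔ M.nat a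
  neg_nat (a : M.D) : S (M.dNeg (M.dNat a)) ↔ ¬M.nat a
  neg_neg (a : M.D) : S (M.dNeg (M.dNeg a)) ↔ S a
  and (a b : M.D) : S (M.dAnd a b) ↔ S a ∧ S b
  neg_and (a b : M.D) : S (M.dNeg (M.dAnd a b)) ↔ S (M.dNeg a) ∨ S (M.dNeg b)
  imp (a b : M.D) : S (M.dImp a b) ↔ S (M.dNeg a) ∨ S b
  neg_imp (a b : M.D) : S (M.dNeg (M.dImp a b)) ↔ S a ∧ S (M.dNeg b)
  all (f : M.D) : S (M.dAll f) ↔ ∀ x, S (M.app f x)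
  neg_all (f : M.D) : S (M.dNeg (M.dAll f)) ↔ ∃ x, S (M.dNeg (M.app f x))
  cons (a : M.D) : ¬(S a ∧ S (M.dNeg a))

theorem IsTruth.or {S : M.D → Prop} (h : M.IsTruth S) (a b : M.D) :
    S (M.dOr a b) ↔ S a ∨ S b := by
  rw [dOr, h.neg_and, h.neg_neg, h.neg_neg]

theorem IsTruth.neg_or {S : M.D → Prop} (h : M.IsTruth S) (a b : M.D) :
    S (M.dNeg (M.dOr a b)) ↔ S (M.dNeg a) ∧ S (M.dNeg b) := by
  rw [dOr, h.neg_neg, h.and]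

theorem isTruth_of_models (h : M.Models KFUPI) : M.IsTruth M.T where
  eq a b := by
    have := (Fm.holds_closure _ _).1 (h _ (.kfu (.kf .eq))) ![a, b]
    simp only [Fm.holds_iff, holds_tr] at this
    exact this
  ne a b := by
    have := (Fm.holds_closure _ _).1 (h _ (.kfu (.kf .ne))) ![a, b]
    simp only [Fm.holds_iff, holds_tr] at this
    exact this
  nat a := by
    have := (Fm.holds_closure _ _).1 (h _ (.kfu (.kf .nat))) ![a]
    simp only [Fm.holds_iff, holds_tr] at this
    exact this
  neg_nat a := by
    have := (Fm.holds_closure _ _).1 (h _ (.kfu (.kf .neg_nat))) ![a]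
    simp only [Fm.holds_iff, holds_tr] at this
    exact this
  neg_neg a := by
    have := (Fm.holds_closure _ _).1 (h _ (.kfu (.kf .neg_neg))) ![a]
    simp only [Fm.holds_iff, holds_tr] at this
    exact this
  and a b := by
    have := (Fm.holds_closure _ _).1 (h _ (.kfu (.kf .and))) ![a, b]
    simp only [Fm.holds_iff, Fm.holds, holds_tr] at this
    exact this
  neg_and a b := by
    have := (Fm.holds_closure _ _).1 (h _ (.kfu (.kf .neg_and))) ![a, b]
    simp only [Fm.holds_iff, Fm.holds_or, holds_tr] at this
    exact this
  imp a b := by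
    have := (Fm.holds_closure _ _).1 (h _ (.kfu (.kf .imp))) ![a, b]
    simp only [Fm.holds_iff, Fm.holds_or, holds_tr] at this
    exact this
  neg_imp a b := by
    have := (Fm.holds_closure _ _).1 (h _ (.kfu (.kf .neg_imp))) ![a, b]
    simp only [Fm.holds_iff, Fm.holds, holds_tr] at this
    exact this
  all f := by
    have := (Fm.holds_closure _ _).1 (h _ (.kfu (.kf .all))) ![f]
    simp only [Fm.holds_iff, Fm.holds, holds_tr] at this
    exact this
  neg_all f := by
    have := (Fm.holds_closure _ _).1 (h _ (.kfu (.kf .neg_all))) ![f]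
    simp only [Fm.holds_iff, Fm.holds_ex, holds_tr] at this
    exact this
  cons a := by
    have := (Fm.holds_closure _ _).1 (h _ (.kfu (.kf .cons))) ![a]
    simp only [Fm.holds, holds_tr] at this
    exact this

/-- Truth in a universe obeys the same compositional clauses as $\mathrm T$, so facts about
`IsTruth` serve for both. -/
theorem isTruth_of_universe (h : M.Models KFUPI) {u : M.D} (hu : M.U u) :
    M.IsTruth fun a => M.T (M.app u a) := by
  have hu' : (un (𝐱 0) : FSFm 1).holds M (push Fin.elim0 u) := (holds_un _).2 hu
  constructor
  · intro a b
    have := h _ (.kfu .eq) u hu' a b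
    simp only [Fm.holds_iff, holds_tr] at this
    exact this
  · intro a b
    have := h _ (.kfu .ne) u hu' a b
    simp only [Fm.holds_iff, holds_tr] at this
    exact this
  · intro a
    have := h _ (.kfu .nat) u hu' a
    simp only [Fm.holds_iff, holds_tr] at this
    exact this
  · intro a
    have := h _ (.kfu .neg_nat) u hu' a
    simp only [Fm.holds_iff, holds_tr] at this
    exact this
  · intro a
    have := h _ (.kfu .neg_neg) u hu' a
    simp only [Fm.holds_iff, holds_tr] at this
    exact this
  · intro a b
    have := h _ (.kfu .and) u hu' a b
    simp only [Fm.holds_iff, Fm.holds, holds_tr] at this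
    exact this
  · intro a b
    have := h _ (.kfu .neg_and) u hu' a b
    simp only [Fm.holds_iff, Fm.holds_or, holds_tr] at this
    exact this
  · intro a b
    have := h _ (.kfu .imp) u hu' a b
    simp only [Fm.holds_iff, Fm.holds_or, holds_tr] at this
    exact this
  · intro a b
    have := h _ (.kfu .neg_imp) u hu' a b
    simp only [Fm.holds_iff, Fm.holds, holds_tr] at this
    exact this
  · intro f
    have := h _ (.kfu .all) u hu' f
    simp only [Fm.holds_iff, Fm.holds, holds_tr] at this
    exact this
  · intro f
    have := h _ (.kfu .neg_all) u hu' f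
    simp only [Fm.holds_iff, Fm.holds_ex, holds_tr] at this
    exact this
  · intro a
    have := h _ (.kfu .cons) u hu' a
    simp only [Fm.holds, holds_tr] at this
    exact this

theorem C_of_universe (h : M.Models KFUPI) {u : M.D} (hu : M.U u) : M.C u :=
  (holds_isClass _).1 (h _ (.kfu .cls) u ((holds_un _).2 hu))

theorem T_of_universe (h : M.Models KFUPI) {u a : M.D} (hu : M.U u) (ha : M.T (M.app u a)) :
    M.T a :=
  (holds_tr _).1 (h _ (.kfu .true) u ((holds_un _).2 hu) a ((holds_tr _).2 ha))

theorem holds_limit (h : M.Models KFUPI) {f : M.D} (hf : M.C f) :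
    M.U (M.lim f) ∧ (∀ x, M.T (M.app f x) → M.T (M.app (M.lim f) (M.app f x))) ∧
      ∀ x, M.T (M.dNeg (M.app f x)) → M.T (M.app (M.lim f) (M.dNeg (M.app f x))) := by
  have := h _ (.kfu .limit) f ((holds_isClass _).2 hf)
  simp only [Fm.holds, reflects, holds_un, holds_tr] at this
  exact this

theorem ext_app_ne (h : M.Models KFUPI) {c d : FSConst} (hcd : c ≠ d) (a b : M.D) :
    M.app (M.ext c) a ≠ M.app (M.ext d) b :=
  (Fm.holds_closure _ _).1 (h _ (.ug (.app_ne c d hcd))) ![a, b]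

theorem ext_app_inj (h : M.Models KFUPI) {c : FSConst} {a b : M.D}
    (hab : M.app (M.ext c) a = M.app (M.ext c) b) : a = b :=
  (Fm.holds_closure _ _).1 (h _ (.ug (.app_inj c))) ![a, b] hab

theorem lim_app_ne (h : M.Models KFUPI) {c : FSConst} (hc : c ≠ .lim) (f a b : M.D) :
    M.app (M.lim f) a ≠ M.app (M.ext c) b :=
  (Fm.holds_closure _ _).1 (h _ (.ug (.lim_ne c hc))) ![f, a, b]

theorem isTON_of_KFUPI (h : M.Models KFUPI) : M.IsTON :=
  isTON_of_models fun _ hA => h _ (.kfu (.kf (.ton hA)))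

/-- The operator of proposition induction. -/
inductive OpA (M : Model FSConst FSRel) (S : M.D → Prop) : M.D → Prop
  | eq (y z : M.D) : OpA M S (M.dEq y z)
  | nat (y : M.D) : OpA M S (M.dNat y)
  | neg (y : M.D) (h : S y) : OpA M S (M.dNeg y)
  | and (y z : M.D) (h : (S y ∧ S z) ∨ (S y ∧ M.T (M.dNeg y)) ∨ (S z ∧ M.T (M.dNeg z))) :
      OpA M S (M.dAnd y z)
  | imp (y z : M.D) (h : (S y ∧ S z) ∨ (S y ∧ M.T (M.dNeg y)) ∨ (S z ∧ M.T z)) :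
      OpA M S (M.dImp y z)
  | all (g : M.D) (h : (∀ y, S (M.app g y)) ∨ ∃ y, S (M.app g y) ∧ M.T (M.dNeg (M.app g y))) :
      OpA M S (M.dAll g)
  | lim (f y : M.D) (h : ∀ z, S (M.app f z)) : OpA M S (M.app (M.lim f) y)

/-- One direction suffices, because $\mathscr A(B,x)$ occurs only as the hypothesis of the step of
proposition induction. -/
theorem opA_of_holds {m : ℕ} (B : FSFm (m + 1)) (ρ : Fin m → M.D) (x : M.D)
    (h : (opA B).holds M (push ρ x)) : M.OpA (fun d => B.holds M (push ρ d)) x := by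
  simp only [opA, Fm.holds_or, Fm.holds_ex, Fm.holds, holds_tr, push_eq_append ρ x, push_append,
    Fm.holds_at_append, FregeStructure.dEq, FregeStructure.dNat, FregeStructure.dNeg,
    FregeStructure.dAnd, FregeStructure.dImp, FregeStructure.dAll, FregeStructure.lim,
    FregeStructure.pair, Tm.eval, Tm.eval_pv, push_cons_one, push_cons_two, push_cons_three] at h
  obtain ⟨y, z, e⟩ | ⟨y, e⟩ | ⟨y, e, h⟩ | ⟨y, z, e, h⟩ | ⟨y, z, e, h⟩ | ⟨g, e, h⟩ | ⟨f, y, e, h⟩ := h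
  · exact (show x = M.dEq y z from e) ▸ OpA.eq y z
  · exact (show x = M.dNat y from e) ▸ OpA.nat y
  · exact (show x = M.dNeg y from e) ▸ OpA.neg y h
  · exact (show x = M.dAnd y z from e) ▸ OpA.and y z h
  · exact (show x = M.dImp y z from e) ▸ OpA.imp y z h
  · exact (show x = M.dAll g from e) ▸ OpA.all g h
  · exact (show x = M.app (M.lim f) y from e) ▸ OpA.lim f y h

theorem prop_induction (h : M.Models KFUPI) {m : ℕ} (B : FSFm (m + 1)) (ρ : Fin m → M.D)
    (hB : ∀ x, M.OpA (fun d => B.holds M (push ρ d)) x → B.holds M (push ρ x)) {x : M.D}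
    (hx : M.P x) : B.holds M (push ρ x) := by
  refine (Fm.holds_closure _ _).1 (h _ (.pi B)) ρ (fun x hx => hB x (opA_of_holds B ρ x hx)) x ?_
  rw [holds_isProp, eval_pv_one]
  exact hx

end FS

end Model
/-! ### Accessible parts -/

namespace Model

section Acc

variable {M : Model FSConst FSRel}

theorem IsTruth.not_T {S : M.D → Prop} (h : M.IsTruth S) {a : M.D} (ha : S (M.dNeg a)) : ¬S a :=
  fun h' => h.cons a ⟨h', ha⟩

theorem IsTruth.neg_iff (h : M.IsTruth M.T) {a : M.D} (ha : M.P a) : M.T (M.dNeg a) ↔ ¬M.T a :=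
  ⟨h.not_T, ha.resolve_left⟩

theorem IsTruth.imp_iff (h : M.IsTruth M.T) {a : M.D} (ha : M.P a) (b : M.D) :
    M.T (M.dImp a b) ↔ (M.T a → M.T b) := by
  rw [h.imp, h.neg_iff ha, imp_iff_not_or]

theorem IsTruth.P_dImp (h : M.IsTruth M.T) {a b : M.D} (ha : M.P a) (hb : M.P b) :
    M.P (M.dImp a b) := by
  rw [P, h.imp, h.neg_imp]
  rw [P] at ha hb
  tauto

theorem IsTruth.P_dAnd (h : M.IsTruth M.T) {a b : M.D} (ha : M.P a) (hb : M.P b) :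
    M.P (M.dAnd a b) := by
  rw [P, h.and, h.neg_and]
  rw [P] at ha hb
  tauto

theorem IsTruth.P_dNeg (h : M.IsTruth M.T) {a : M.D} (ha : M.P a) : M.P (M.dNeg a) := by
  rw [P, h.neg_neg]
  exact ha.symm

theorem IsTruth.P_dOr (h : M.IsTruth M.T) {a b : M.D} (ha : M.P a) (hb : M.P b) :
    M.P (M.dOr a b) := by
  rw [P, h.or, h.neg_or]
  rw [P] at ha hb
  tauto

theorem IsTruth.P_dEq (h : M.IsTruth M.T) (a b : M.D) : M.P (M.dEq a b) := by
  rw [P, h.eq, h.ne]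
  exact em _

theorem IsTruth.P_dNat (h : M.IsTruth M.T) (a : M.D) : M.P (M.dNat a) := by
  rw [P, h.nat, h.neg_nat]
  exact em _

/-- By classical logic, if not all instances are true then some instance is not true; being a
proposition, it is false, which refutes the quantified statement. -/
theorem IsTruth.P_dAll (h : M.IsTruth M.T) {f : M.D} (hf : M.C f) : M.P (M.dAll f) := by
  rw [P, h.all, h.neg_all]
  by_cases h' : ∀ x, M.T (M.app f x)
  · exact .inl h'
  · obtain ⟨x, hx⟩ := not_forall.1 h'
    exact .inr ⟨x, (hf x).resolve_left hx⟩

/-! #### The defining equations -/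

/-- `(0, x)` belongs to the class `e`. -/
def Field (M : Model FSConst FSRel) (e x : M.D) : M.D := M.app e (M.pair M.zero x)

/-- `(1, (y, x))` belongs to the class `e`. -/
def Below (M : Model FSConst FSRel) (e y x : M.D) : M.D :=
  M.app e (M.pair (M.suc M.zero) (M.pair y x))

/-- The defining equation of `t`, for the class `e` in the place of `⊕(u, v)`. -/
def IsAccRec (M : Model FSConst FSRel) (e t : M.D) : Prop :=
  ∀ w, ∃ g, M.app t w = M.dAll g ∧
    ∀ y, M.app g y = M.dImp (M.Field e y) (M.dImp (M.Below e y w) (M.app t y))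

/-- The defining equation of `acc`, for the class `e` in the place of `⊕(u, v)`. -/
def IsAcc (M : Model FSConst FSRel) (e t c : M.D) : Prop :=
  ∀ x, ∃ g, M.app c x = M.dAnd (M.Field e x) (M.dAll g) ∧
    ∀ y, M.app g y =
      M.dImp (M.Field e y) (M.dImp (M.Below e y x) (M.app (M.lim e) (M.app t y)))

variable {n : ℕ} {ρ : Fin n → M.D}

theorem IsTON.eval_oplus (h : M.IsTON) (u v : FSTm n) (z : M.D) :
    M.app ((oplus u v).eval M ρ) z =
      M.dOr (M.dAnd (M.dEq (M.fst z) M.zero) (M.app (u.eval M ρ) (M.snd z)))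
        (M.dAnd (M.dNeg (M.dEq (M.fst z) M.zero)) (M.app (v.eval M ρ) (M.snd z))) := by
  rw [oplus, h.eval_lam]
  simp only [FregeStructure.dOr, FregeStructure.dEq, FregeStructure.dNeg, FregeStructure.dAnd,
    FregeStructure.fst, FregeStructure.snd, FregeStructure.pair, Tm.eval, Tm.eval_wk_one,
    eval_pv_one]
  rfl

theorem IsTON.eval_predAll (h : M.IsTON) (u v w : FSTm n) (r : FSTm (n + 1)) :
    ∃ g, (predAll u v w r).eval M ρ = M.dAll g ∧ ∀ y, M.app g y =
      M.dImp (M.Field ((oplus u v).eval M ρ) y)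
        (M.dImp (M.Below ((oplus u v).eval M ρ) y (w.eval M ρ)) (r.eval M (push ρ y))) := by
  refine ⟨_, rfl, fun y => ?_⟩
  rw [h.eval_lam]
  simp only [FregeStructure.dImp, FregeStructure.suc, FregeStructure.pair, Tm.eval, Tm.eval_wk_one,
    eval_pv_one]
  rfl

/-- The fixed point equation of `recTm`, followed by two β-steps. -/
theorem IsTON.isAccRec (h : M.IsTON) (u v : FSTm n) :
    M.IsAccRec ((oplus u v).eval M ρ) ((accRec u v).eval M ρ) := by
  intro w
  have e : M.app ((accRec u v).eval M ρ) w =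
      (predAll (u.wk 2) (v.wk 2) (pv n (j := 2) 1) (pv n (j := 3) 0 ⬝ pv n (j := 3) 2)).eval M
        (push (push ρ ((accRec u v).eval M ρ)) w) := by
    conv_lhs => rw [accRec, Tm.eval, h.eval_recTm, h.eval_lam]
    exact h.eval_lam (n := n + 1) _ _ _
  rw [e]
  obtain ⟨g, hg, hg'⟩ := h.eval_predAll (u.wk 2) (v.wk 2) (pv n (j := 2) 1)
    (pv n (j := 3) 0 ⬝ pv n (j := 3) 2) (ρ := push (push ρ ((accRec u v).eval M ρ)) w)
  refine ⟨g, hg, fun y => ?_⟩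
  -- `oplus_wk` identifies the class formed under the two abstractions with the original one, so the
  -- parameter `e` stays the same.
  rw [hg', oplus_wk, Tm.eval_wk_two]
  simp only [push_eq_append ρ, push_append, push_cons_one, push_cons_two, Tm.eval, Tm.eval_pv]
  rfl

theorem IsTON.isAcc (h : M.IsTON) (u v : FSTm n) :
    M.IsAcc ((oplus u v).eval M ρ) ((accRec u v).eval M ρ) ((accOf u v).eval M ρ) := by
  intro x
  obtain ⟨g, hg, hg'⟩ := h.eval_predAll (u.wk 1) (v.wk 1) (pv n (j := 1) 0)
    (FregeStructure.lim ((oplus u v).wk 2) ⬝ ((accRec u v).wk 2 ⬝ pv n (j := 2) 1))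
    (ρ := push ρ x)
  refine ⟨g, ?_, fun y => ?_⟩
  · rw [accOf, h.eval_lam]
    simp only [FregeStructure.dAnd, FregeStructure.pair, Tm.eval, Tm.eval_wk_one, eval_pv_one, hg]
    rfl
  · rw [hg', oplus_wk, Tm.eval_wk_one, eval_pv_one]
    simp only [FregeStructure.lim, Tm.eval, Tm.eval_wk_two]
    rw [push_eq_append ρ, push_append, push_cons_one, Tm.eval_pv]
    rfl

/-! #### Closure and induction -/

variable {e t c : M.D}

/-- Truth in the universe implies truth, and falsity of $ez$ is reflected into it. Only the negative
half of $e\sqsubset\mathsf l e$ is needed, since the facts about $e$ are used as antecedents. -/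
theorem lim_T_iff (h : M.Models KFUPI) (he : M.C e) (z : M.D) :
    M.T (M.app (M.lim e) (M.dNeg (M.app e z))) ↔ ¬M.T (M.app e z) := by
  obtain ⟨hU, -, h₂⟩ := holds_limit h he
  have hT := isTruth_of_models h
  exact ⟨fun h' => hT.not_T (T_of_universe h hU h'), fun h' => h₂ z ((he z).resolve_left h')⟩

/-- The fixed point equation is evaluated by the clauses for $\dot\forall$ and $\dot\to$ in the
universe. Both antecedents are decided there by `lim_T_iff`, so the implications become ordinary
ones. -/
theorem accRec_iff (h : M.Models KFUPI) (he : M.C e) (ht : M.IsAccRec e t) (w : M.D) :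
    M.T (M.app (M.lim e) (M.app t w)) ↔ ∀ y, M.T (M.Field e y) → M.T (M.Below e y w) →
      M.T (M.app (M.lim e) (M.app t y)) := by
  have hS := isTruth_of_universe h (holds_limit h he).1
  obtain ⟨g, hg, hg'⟩ := ht w
  rw [hg, hS.all]
  refine forall_congr' fun y => ?_
  rw [hg', hS.imp, hS.imp, Field, Below, lim_T_iff h he, lim_T_iff h he]
  tauto

theorem acc_iff (h : M.Models KFUPI) (he : M.C e) (hc : M.IsAcc e t c) (x : M.D) :
    M.T (M.app c x) ↔ M.T (M.Field e x) ∧ ∀ y, M.T (M.Field e y) → M.T (M.Below e y x) →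
      M.T (M.app (M.lim e) (M.app t y)) := by
  have hT := isTruth_of_models h
  obtain ⟨g, hg, hg'⟩ := hc x
  rw [hg, hT.and, hT.all]
  refine and_congr_right fun _ => forall_congr' fun y => ?_
  rw [hg', Field, Below, hT.imp_iff (he _), hT.imp_iff (he _)]

/-- The recursive object $ty$ occurs in $\mathsf{acc}$ only under $\mathsf l e$, which is a total
class. This is what the universe is for. -/
theorem acc_C (h : M.Models KFUPI) (he : M.C e) (hc : M.IsAcc e t c) : M.C c := by
  have hT := isTruth_of_models h
  intro x
  obtain ⟨g, hg, hg'⟩ := hc x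
  rw [hg]
  refine hT.P_dAnd (he _) (hT.P_dAll fun y => ?_)
  rw [hg']
  exact hT.P_dImp (he _) (hT.P_dImp (he _) (C_of_universe h (holds_limit h he).1 _))

theorem acc_iff_and (h : M.Models KFUPI) (he : M.C e) (ht : M.IsAccRec e t) (hc : M.IsAcc e t c)
    (x : M.D) :
    M.T (M.app c x) ↔ M.T (M.Field e x) ∧ M.T (M.app (M.lim e) (M.app t x)) := by
  rw [acc_iff h he hc, ← accRec_iff h he ht]

/-- `acc_iff` asks for $\mathsf l e(ty)$ only at the predecessors $y$ of $x$, and `acc_iff_and`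
supplies it from their membership. -/
theorem acc_closed (h : M.Models KFUPI) (he : M.C e) (ht : M.IsAccRec e t) (hc : M.IsAcc e t c)
    {x : M.D} (hx : M.T (M.Field e x))
    (hy : ∀ y, M.T (M.Field e y) → M.T (M.Below e y x) → M.T (M.app c y)) : M.T (M.app c x) :=
  (acc_iff h he hc x).2
    ⟨hx, fun y h₁ h₂ => ((acc_iff_and h he ht hc y).1 (hy y h₁ h₂)).2⟩

/-- The statement that `A` holds of the accessible element `x`; the context of `A` is enlarged by
`e`, `t` and three further variables. -/
def accFm {m : ℕ} (A : FSFm (m + 1)) (x : Fin 5) : FSFm (m + 5) :=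
  tr (FregeStructure.lim (pv m (j := 5) 0) ⬝ (pv m (j := 5) 1 ⬝ pv m x)) ➝
    tr (pv m (j := 5) 0 ⬝ FregeStructure.pair FregeStructure.zero (pv m x)) ➝ A.at (pv m x)

/-- The formula for which the proof of induction on `acc` uses proposition induction. -/
def accIndFm {m : ℕ} (A : FSFm (m + 1)) : FSFm (m + 3) :=
  let field : FSTm (m + 5) :=
    pv m (j := 5) 0 ⬝ FregeStructure.pair FregeStructure.zero (pv m (j := 5) 4)
  let below : FSTm (m + 5) := pv m (j := 5) 0 ⬝ FregeStructure.pair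
    (FregeStructure.suc FregeStructure.zero)
    (FregeStructure.pair (pv m (j := 5) 4) (pv m (j := 5) 3))
  let value : FSTm (m + 5) := pv m (j := 5) 1 ⬝ pv m (j := 5) 4
  -- The five additional variables are $e,t,z,x,y$, and induction is on $z$. The clauses are the
  -- three shapes met in descending from $tx$ to $ty$: $tx$ itself, the instance of its
  -- $\dot\forall$, and the consequent of that instance. A single formula must cover all three,
  -- since proposition induction passes only to immediate components.
  .all (n := m + 3) (.all (n := m + 4)
    ((pv m (j := 5) 2 ≐ pv m (j := 5) 1 ⬝ pv m (j := 5) 3 ➝ accFm A 3) ⋏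
      (pv m (j := 5) 2 ≐ FregeStructure.dImp field (FregeStructure.dImp below value) ➝
        tr field ➝ tr below ➝ accFm A 4) ⋏
      (pv m (j := 5) 2 ≐ FregeStructure.dImp below value ➝ tr below ➝ accFm A 4)))

theorem holds_accFm {m : ℕ} (A : FSFm (m + 1)) (ρ : Fin m → M.D) (v : Fin 5 → M.D) (x : Fin 5) :
    (accFm A x).holds M (Fin.append ρ v) ↔
      (M.T (M.app (M.lim (v 0)) (M.app (v 1) (v x))) → M.T (M.Field (v 0) (v x)) →
        A.holds M (push ρ (v x))) := by
  simp only [accFm, Fm.holds, holds_tr, Fm.holds_at_append, FregeStructure.lim,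
    FregeStructure.pair, FregeStructure.zero, Tm.eval, Tm.eval_pv]
  rfl

theorem holds_accIndFm {m : ℕ} (A : FSFm (m + 1)) (ρ : Fin m → M.D) (e t z : M.D) :
    (accIndFm A).holds M (push (push (push ρ e) t) z) ↔ ∀ x y,
      (z = M.app t x → M.T (M.app (M.lim e) (M.app t x)) → M.T (M.Field e x) →
        A.holds M (push ρ x)) ∧
      (z = M.dImp (M.Field e y) (M.dImp (M.Below e y x) (M.app t y)) → M.T (M.Field e y) →
        M.T (M.Below e y x) → M.T (M.app (M.lim e) (M.app t y)) → M.T (M.Field e y) →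
        A.holds M (push ρ y)) ∧
      (z = M.dImp (M.Below e y x) (M.app t y) → M.T (M.Below e y x) →
        M.T (M.app (M.lim e) (M.app t y)) → M.T (M.Field e y) → A.holds M (push ρ y)) := by
  simp only [accIndFm, Fm.holds, holds_tr, push_eq_append ρ e, push_append, push_cons_one,
    push_cons_two, push_cons_three, push_cons_four, holds_accFm, FregeStructure.dImp,
    FregeStructure.pair, FregeStructure.zero, FregeStructure.suc, Tm.eval, Tm.eval_pv]
  rfl

theorem dImp_inj (h : M.Models KFUPI) {a b c d : M.D} (e : M.dImp a b = M.dImp c d) :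
    a = c ∧ b = d := by
  have h' := ext_app_inj h e
  have hM := isTON_of_KFUPI h
  exact ⟨by rw [← hM.fst_pair a b, h', hM.fst_pair], by rw [← hM.snd_pair a b, h', hM.snd_pair]⟩

/-- By (UG) only the implication case of $\mathscr A$ can apply. A true antecedent rules out its
disjunct with a false antecedent, and both remaining disjuncts give `S b`. -/
theorem OpA.of_dImp (h : M.Models KFUPI) {S : M.D → Prop} {a b : M.D}
    (hz : M.OpA S (M.dImp a b)) (ha : M.T a) : S b := by
  have hT := isTruth_of_models h
  generalize hw : M.dImp a b = w at hz
  cases hz with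
  | imp y z h' =>
    obtain ⟨rfl, rfl⟩ := dImp_inj h hw
    obtain h' | h' | h' := h'
    exacts [h'.2, absurd ha (hT.not_T h'.2), h'.1]
  | lim f y _ => exact absurd hw.symm (lim_app_ne h (by simp) _ _ _)
  | _ => exact absurd hw (ext_app_ne h (by simp) _ _)

/-- By (UG) only the quantifier case can apply, and truth of $\dot\forall g$ rules out the disjunct
with a false instance. -/
theorem OpA.of_dAll (h : M.Models KFUPI) {S : M.D → Prop} {g : M.D}
    (hz : M.OpA S (M.dAll g)) (hg : M.T (M.dAll g)) (y : M.D) : S (M.app g y) := by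
  have hT := isTruth_of_models h
  generalize hw : M.dAll g = w at hz
  cases hz with
  | all f h' =>
    obtain rfl := ext_app_inj h hw
    obtain h' | ⟨z, -, h'⟩ := h'
    exacts [h' y, absurd ((hT.all _).1 hg z) (hT.not_T h')]
  | lim f y _ => exact absurd hw.symm (lim_app_ne h (by simp) _ _ _)
  | _ => exact absurd hw (ext_app_ne h (by simp) _ _)

theorem acc_induction (h : M.Models KFUPI) (he : M.C e) (ht : M.IsAccRec e t)
    (hc : M.IsAcc e t c) {m : ℕ} (A : FSFm (m + 1)) (ρ : Fin m → M.D)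
    (hA : ∀ x, M.T (M.Field e x) → (∀ y, M.T (M.Field e y) → M.T (M.Below e y x) →
      A.holds M (push ρ y)) → A.holds M (push ρ x)) {x : M.D} (hx : M.T (M.app c x)) :
    A.holds M (push ρ x) := by
  obtain ⟨hx₁, hx₂⟩ := (acc_iff_and h he ht hc x).1 hx
  have hU := (holds_limit h he).1
  have key : (accIndFm A).holds M (push (push (push ρ e) t) (M.app t x)) := by
    -- Truth of $tx$ in the universe gives its truth, hence that it is a proposition.
    refine prop_induction h (accIndFm A) (push (push ρ e) t) (fun z hz => ?_)
      (.inl (T_of_universe h hU hx₂))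
    rw [holds_accIndFm]
    refine fun x y => ⟨?_, ?_, ?_⟩
    · rintro rfl hx₁ hx₂
      obtain ⟨g, hg, hg'⟩ := ht x
      refine hA x hx₂ fun y hy₁ hy₂ => ?_
      have h₁ := T_of_universe h hU hx₁
      rw [hg] at hz h₁
      have h₂ := (holds_accIndFm A ρ e t _).1 (hz.of_dAll h h₁ y)
      -- The instance `M.app g y` has the second shape. The truth of $ty$ in the universe, required
      -- by the later clauses, comes from `accRec_iff`.
      exact (h₂ x y).2.1 (hg' y) hy₁ hy₂ ((accRec_iff h he ht x).1 hx₁ y hy₁ hy₂) hy₁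
    · rintro rfl hy hxy
      exact ((holds_accIndFm A ρ e t _).1 (hz.of_dImp h hy) x y).2.2 rfl hxy
    · rintro rfl hxy
      -- The descent has reached $ty$, so the first clause is used with $y$ in the place of $x$.
      exact ((holds_accIndFm A ρ e t _).1 (hz.of_dImp h hxy) y y).1 rfl
  exact ((holds_accIndFm A ρ e t _).1 key x x).1 rfl hx₂ hx₁

end Acc

end Model
/-! ### The interpretation -/

namespace Model

section AccTerm

variable {M : Model FSConst FSRel} {n : ℕ} {ρ : Fin n → M.D} {u v : FSTm n}

theorem T_field_oplus (h : M.Models KFUPI) (x : M.D) :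
    M.T (M.Field ((oplus u v).eval M ρ) x) ↔ M.T (M.app (u.eval M ρ) x) := by
  have hT := isTruth_of_models h
  have hM := isTON_of_KFUPI h
  simp [Field, hM.eval_oplus, hM.fst_pair, hM.snd_pair, hT.or, hT.and, hT.eq, hT.ne]

/-- The tag $1$ differs from $\mathsf 0$, so the first disjunct of $\oplus$ fails and the second
yields the relation $b$. -/
theorem T_below_oplus (h : M.Models KFUPI) (x y : M.D) :
    M.T (M.Below ((oplus u v).eval M ρ) y x) ↔ M.T (M.app (v.eval M ρ) (M.pair y x)) := by
  have hT := isTruth_of_models h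
  have hM := isTON_of_KFUPI h
  simp [Below, hM.eval_oplus, hM.fst_pair, hM.snd_pair, hT.or, hT.and, hT.eq, hT.ne,
    hM.suc_ne _ hM.nat_zero]

theorem C_oplus (h : M.Models KFUPI) (hu : M.C (u.eval M ρ)) (hv : M.C (v.eval M ρ)) :
    M.C ((oplus u v).eval M ρ) := by
  have hT := isTruth_of_models h
  intro z
  rw [(isTON_of_KFUPI h).eval_oplus]
  exact hT.P_dOr (hT.P_dAnd (hT.P_dEq _ _) (hu _)) (hT.P_dAnd (hT.P_dNeg (hT.P_dEq _ _)) (hv _))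

variable (M) in
/-- The value of `acc(a, b)`. -/
def acc (a b : M.D) : M.D := M.app (FregeStructure.acc.eval M Fin.elim0) (M.pair a b)

theorem exists_acc (h : M.Models KFUPI) {a b : M.D} (ha : M.C a) (hb : M.C b) :
    ∃ e t, M.C e ∧ M.IsAccRec e t ∧ M.IsAcc e t (M.acc a b) ∧
      (∀ x, M.T (M.Field e x) ↔ M.T (M.app a x)) ∧
      ∀ x y, M.T (M.Below e y x) ↔ M.T (M.app b (M.pair y x)) := by
  have hM := isTON_of_KFUPI h
  have hu : (FregeStructure.fst (𝐱 0) : FSTm 1).eval M (push Fin.elim0 (M.pair a b)) = a :=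
    hM.fst_pair a b
  have hv : (FregeStructure.snd (𝐱 0) : FSTm 1).eval M (push Fin.elim0 (M.pair a b)) = b :=
    hM.snd_pair a b
  refine ⟨_, _, C_oplus h (hu.symm ▸ ha) (hv.symm ▸ hb), hM.isAccRec _ _, ?_,
    fun x => (T_field_oplus h x).trans (by rw [hu]),
    fun x y => (T_below_oplus h x y).trans (by rw [hv])⟩
  rw [acc, FregeStructure.acc, hM.eval_lam]
  exact hM.isAcc _ _

theorem C_acc (h : M.Models KFUPI) {a b : M.D} (ha : M.C a) (hb : M.C b) : M.C (M.acc a b) := by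
  obtain ⟨e, t, he, -, hc, -⟩ := exists_acc h ha hb
  exact acc_C h he hc

theorem T_acc_of_closed (h : M.Models KFUPI) {a b x : M.D} (ha : M.C a) (hb : M.C b)
    (hx : M.T (M.app a x)) (hy : ∀ y, M.T (M.app a y) → M.T (M.app b (M.pair y x)) →
      M.T (M.app (M.acc a b) y)) : M.T (M.app (M.acc a b) x) := by
  obtain ⟨e, t, he, ht, hc, h₁, h₂⟩ := exists_acc h ha hb
  exact acc_closed h he ht hc ((h₁ x).2 hx) fun y hy₁ hy₂ => hy y ((h₁ y).1 hy₁) ((h₂ x y).1 hy₂)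

theorem induction_on_acc (h : M.Models KFUPI) {a b : M.D} (ha : M.C a) (hb : M.C b) {m : ℕ}
    (A : FSFm (m + 1)) (ρ : Fin m → M.D)
    (hA : ∀ x, M.T (M.app a x) → (∀ y, M.T (M.app a y) → M.T (M.app b (M.pair y x)) →
      A.holds M (push ρ y)) → A.holds M (push ρ x))
    (x : M.D) (hx : M.T (M.app (M.acc a b) x)) : A.holds M (push ρ x) := by
  obtain ⟨e, t, he, ht, hc, h₁, h₂⟩ := exists_acc h ha hb
  refine acc_induction h he ht hc A ρ (fun x hx hy => hA x ((h₁ x).1 hx) fun y hy₁ hy₂ => ?_) hx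
  exact hy y ((h₁ y).2 hy₁) ((h₂ x y).2 hy₂)

end AccTerm

theorem holds_closedFS {M : Model FSConst FSRel} {n : ℕ} (a b : FSTm n) (A : FSFm (n + 1))
    (ρ : Fin n → M.D) : (closedFS a b A).holds M ρ ↔ ∀ x, M.T (M.app (a.eval M ρ) x) →
      (∀ y, M.T (M.app (a.eval M ρ) y) → M.T (M.app (b.eval M ρ) (M.pair y x)) →
        A.holds M (push ρ y)) → A.holds M (push ρ x) := by
  simp only [closedFS, Fm.holds, holds_tr, push_eq_append ρ, push_append, push_cons_one,
    Fm.holds_at_append, FregeStructure.pair, Tm.eval, Tm.eval_pv, Tm.eval_wk_append]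
  rfl

end Model

instance (k : ℕ) : Countable (FSRel k) :=
  Function.Injective.countable (f := fun r : FSRel k => r.ctorIdx) fun r s h => by
    cases r <;> cases s <;> first | rfl | cases h

instance : Countable FSConst :=
  Function.Injective.countable (f := FSConst.ctorIdx) fun c d h => by
    cases c <;> cases d <;> first | rfl | cases h

theorem accInduction_provable {m : ℕ} (A : FSFm (m + 2 + 1)) :
    Provable KFUPI (accInduction A) := by
  refine provable_of_holds fun M h => (Fm.holds_closure _ _).2 fun ρ => ?_
  obtain ⟨ρ, v, rfl⟩ := exists_append ρ
  rintro ⟨ha, hb, hA⟩ x hx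
  rw [Model.holds_isClass, Tm.eval_pv] at ha hb
  rw [Model.holds_closedFS, Tm.eval_pv, Tm.eval_pv] at hA
  refine Model.induction_on_acc h ha hb A _ hA x ?_
  simp only [push_append, Model.holds_tr, pair, Tm.eval, Tm.eval_lift, Tm.eval_pv] at hx
  exact hx

/-- The closed terms that interpret the generators. -/
def genTm : Gen → FSTm 0
  | .nat => .ext .nat
  -- An object has the form $(y,y)$ exactly if it equals the pair formed from its first projection
  -- twice, so no quantifier is needed. For `dom` the existential quantifier is expressed as
  -- $\dot\neg\dot\forall\dot\neg$.
  | .id => lam (dEq (𝐱 0) (pair (fst (𝐱 0)) (fst (𝐱 0))))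
  | .co => lam (lam (dNeg (𝐱 0 ⬝ 𝐱 1)))
  | .int => lam (lam (dAnd (fst (𝐱 0) ⬝ 𝐱 1) (snd (𝐱 0) ⬝ 𝐱 1)))
  | .dom => lam (lam (dNeg (dAll (lam (dNeg (𝐱 0 ⬝ pair (𝐱 1) (𝐱 2)))))))
  | .inv => lam (lam (fst (𝐱 0) ⬝ (snd (𝐱 0) ⬝ 𝐱 1)))
  | .join => lam (lam (dAnd (dEq (𝐱 1) (pair (fst (𝐱 1)) (snd (𝐱 1))))
      (dAnd (fst (𝐱 0) ⬝ fst (𝐱 1)) (snd (𝐱 0) ⬝ fst (𝐱 1) ⬝ snd (𝐱 1)))))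
  | .ig => acc

/-! ### The reduct as a model of $\mathsf T_0$. -/

namespace Model

/-- The relations of `L_EM`, as read in a structure for `L_FS`. -/
def reductRel (M : Model FSConst FSRel) : {k : ℕ} → EMRel k → (Fin k → M.D) → Prop
  | _, .R, v => M.C (v 0)
  | _, .mem, v => M.T (M.app (v 1) (v 0))

/-- The structure for `L_EM` that the translation determines. -/
def reduct (τ : Gen → FSTm 0) (M : Model FSConst FSRel) : Model Gen EMRel where
  D := M.D
  base := M.base
  ext g := (τ g).eval M Fin.elim0
  app := M.app
  nat := M.nat
  rel := M.reductRel

variable {τ : Gen → FSTm 0} {M : Model FSConst FSRel} {n : ℕ}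

theorem eval_transTm (ρ : Fin n → M.D) (t : EMTm n) :
    (transTm τ t).eval M ρ = t.eval (M.reduct τ) ρ := by
  induction t with
  | var i => rfl
  | base c => rfl
  | ext g => exact Tm.eval_lift _ _
  | app a b iha ihb =>
    simp only [transTm, Tm.eval, iha, ihb]
    rfl

theorem holds_trans (ρ : Fin n → M.D) (A : EMFm n) :
    (trans τ A).holds M ρ ↔ A.holds (M.reduct τ) ρ := by
  induction A with
  | eq a b => simp only [trans, Fm.holds, eval_transTm]; rfl
  | nat a => simp only [trans, Fm.holds, eval_transTm]; rfl
  | rel r ts =>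
    cases r with
    | R =>
      simp only [trans, transRel, holds_isClass, eval_transTm]
      rfl
    | mem =>
      simp only [trans, transRel, holds_tr, Tm.eval, eval_transTm]
      rfl
  | neg A ih => exact not_congr (ih ρ)
  | and A B ihA ihB => exact and_congr (ihA ρ) (ihB ρ)
  | imp A B ihA ihB => exact imp_congr (ihA ρ) (ihB ρ)
  | all A ih => exact forall_congr' fun d => ih (push ρ d)

/-- Only induction requires an argument: for an $\mathcal L_{EM}$-formula it is the instance in `M`
for the translated formula. -/
theorem IsTON.reduct (h : M.IsTON) : (M.reduct τ).IsTON where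
  k := h.k
  s := h.s
  fst_pair := h.fst_pair
  snd_pair := h.snd_pair
  nat_zero := h.nat_zero
  nat_suc := h.nat_suc
  suc_ne := h.suc_ne
  pred_suc := h.pred_suc
  nat_pred := h.nat_pred
  suc_pred := h.suc_pred
  cases_eq := h.cases_eq
  cases_ne := h.cases_ne
  induction A ρ h₀ h₁ x hx := (holds_trans _ A).1 (h.induction (trans τ A) ρ
    ((holds_trans _ A).2 h₀) (fun y hy hA => (holds_trans _ A).2 (h₁ y hy ((holds_trans _ A).1 hA)))
    x hx)

theorem holds_closedEM {N : Model Gen EMRel} (a b : EMTm n) (A : EMFm (n + 1)) (ρ : Fin n → N.D) :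
    (closedEM a b A).holds N ρ ↔ ∀ x, N.rel EMRel.mem ![x, a.eval N ρ] →
      (∀ y, N.rel EMRel.mem ![y, a.eval N ρ] → N.rel EMRel.mem ![N.pair y x, b.eval N ρ] →
        A.holds N (push ρ y)) → A.holds N (push ρ x) := by
  have hm {k : ℕ} (a b : EMTm k) (ρ : Fin k → N.D) :
      (mem a b).holds N ρ ↔ N.rel EMRel.mem ![a.eval N ρ, b.eval N ρ] :=
    iff_of_eq (congrArg (N.rel EMRel.mem) (funext fun i => by fin_cases i <;> rfl))
  simp only [closedEM, Fm.holds, hm, push_eq_append ρ, push_append, push_cons_one,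
    Fm.holds_at_append, FregeStructure.pair, Tm.eval, Tm.eval_pv, Tm.eval_wk_append]
  rfl

theorem IsTON.eval_lam_lam (h : M.IsTON) (t : FSTm 2) (a b : M.D) :
    M.app (M.app ((lam (lam t)).eval M Fin.elim0) a) b = t.eval M (push (push Fin.elim0 a) b) := by
  rw [h.eval_lam, h.eval_lam]

variable (M) in
/-- The value of the term that interprets a generator. -/
def gen (g : Gen) : M.D := (genTm g).eval M Fin.elim0

variable {a b f : M.D}

theorem gen_id (h : M.Models KFUPI) :
    M.C (M.gen .id) ∧ ∀ x, M.T (M.app (M.gen .id) x) ↔ ∃ y, x = M.pair y y := by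
  have hT := isTruth_of_models h
  have hM := isTON_of_KFUPI h
  have e (x : M.D) : M.app (M.gen .id) x = M.dEq x (M.pair (M.fst x) (M.fst x)) :=
    hM.eval_lam _ _ _
  refine ⟨fun x => e x ▸ hT.P_dEq _ _, fun x => ?_⟩
  rw [e, hT.eq]
  refine ⟨fun hx => ⟨_, hx⟩, ?_⟩
  rintro ⟨y, rfl⟩
  rw [hM.fst_pair]

theorem gen_co (h : M.Models KFUPI) (ha : M.C a) : M.C (M.app (M.gen .co) a) ∧
    ∀ x, M.T (M.app (M.app (M.gen .co) a) x) ↔ ¬M.T (M.app a x) := by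
  have hT := isTruth_of_models h
  have e (x : M.D) : M.app (M.app (M.gen .co) a) x = M.dNeg (M.app a x) :=
    (isTON_of_KFUPI h).eval_lam_lam _ _ _
  exact ⟨fun x => e x ▸ hT.P_dNeg (ha x), fun x => by rw [e, hT.neg_iff (ha x)]⟩

theorem gen_int (h : M.Models KFUPI) (ha : M.C a) (hb : M.C b) :
    M.C (M.app (M.gen .int) (M.pair a b)) ∧
    ∀ x, M.T (M.app (M.app (M.gen .int) (M.pair a b)) x) ↔ M.T (M.app a x) ∧ M.T (M.app b x) := by
  have hT := isTruth_of_models h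
  have hM := isTON_of_KFUPI h
  have e (p x : M.D) : M.app (M.app (M.gen .int) p) x =
      M.dAnd (M.app (M.fst p) x) (M.app (M.snd p) x) := hM.eval_lam_lam _ _ _
  simp only [C, e, hM.fst_pair, hM.snd_pair, hT.and]
  exact ⟨fun x => hT.P_dAnd (ha x) (hb x), fun _ => trivial⟩

theorem gen_dom (h : M.Models KFUPI) (ha : M.C a) : M.C (M.app (M.gen .dom) a) ∧
    ∀ x, M.T (M.app (M.app (M.gen .dom) a) x) ↔ ∃ y, M.T (M.app a (M.pair x y)) := by
  have hT := isTruth_of_models h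
  have hM := isTON_of_KFUPI h
  have e (x : M.D) : ∃ g, M.app (M.app (M.gen .dom) a) x = M.dNeg (M.dAll g) ∧
      ∀ y, M.app g y = M.dNeg (M.app a (M.pair x y)) :=
    ⟨_, hM.eval_lam_lam _ _ _, fun y => hM.eval_lam _ _ _⟩
  constructor <;> intro x <;> obtain ⟨g, hg, hg'⟩ := e x
  · rw [hg]
    exact hT.P_dNeg (hT.P_dAll fun y => hg' y ▸ hT.P_dNeg (ha _))
  · simp only [hg, hT.neg_all, hg', hT.neg_neg]

theorem gen_inv (h : M.Models KFUPI) (ha : M.C a) : M.C (M.app (M.gen .inv) (M.pair a f)) ∧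
    ∀ x, M.T (M.app (M.app (M.gen .inv) (M.pair a f)) x) ↔ M.T (M.app a (M.app f x)) := by
  have hM := isTON_of_KFUPI h
  have e (p x : M.D) : M.app (M.app (M.gen .inv) p) x = M.app (M.fst p) (M.app (M.snd p) x) :=
    hM.eval_lam_lam _ _ _
  simp only [C, e, hM.fst_pair, hM.snd_pair]
  exact ⟨fun x => ha _, fun _ => trivial⟩

theorem gen_join (h : M.Models KFUPI) (ha : M.C a)
    (hf : ∀ x, M.T (M.app a x) → M.C (M.app f x)) : M.C (M.app (M.gen .join) (M.pair a f)) ∧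
    ∀ x, M.T (M.app (M.app (M.gen .join) (M.pair a f)) x) ↔
      ∃ v w, x = M.pair v w ∧ M.T (M.app a v) ∧ M.T (M.app (M.app f v) w) := by
  have hT := isTruth_of_models h
  have hM := isTON_of_KFUPI h
  have e (p x : M.D) : M.app (M.app (M.gen .join) p) x =
      M.dAnd (M.dEq x (M.pair (M.fst x) (M.snd x))) (M.dAnd (M.app (M.fst p) (M.fst x))
        (M.app (M.app (M.snd p) (M.fst x)) (M.snd x))) := hM.eval_lam_lam _ _ _
  simp only [C, e, hM.fst_pair, hM.snd_pair, hT.and, hT.eq]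
  refine ⟨fun x => hT.P_dAnd (hT.P_dEq _ _) ?_, fun x => ⟨fun hx => ⟨_, _, hx⟩, ?_⟩⟩
  · by_cases hx : M.T (M.app a (M.fst x))
    · exact hT.P_dAnd (.inl hx) (hf _ hx _)
    -- Outside $a$ nothing is known about the values of $f$. There the false first conjunct alone
    -- refutes the conjunction, which is therefore still a proposition.
    · exact .inr ((hT.neg_and _ _).2 (.inl ((ha _).resolve_left hx)))
  · rintro ⟨v, w, rfl, hx⟩
    simpa only [hM.fst_pair, hM.snd_pair, true_and] using hx

theorem holds_iff_of {N : Model Gen EMRel} {A B : EMFm n} {ρ : Fin n → N.D}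
    (h : A.holds N ρ ↔ B.holds N ρ) : (A ⭤ B).holds N ρ := (Fm.holds_iff _ _ _).2 h

theorem reduct_models_EM (h : M.Models KFUPI) : (M.reduct genTm).Models EM := by
  have hT := isTruth_of_models h
  intro A hA
  cases hA with
  | ton hA => exact (isTON_of_KFUPI h).reduct.models _ hA
  | nat => exact ⟨fun x => hT.P_dNat x, fun x => holds_iff_of (hT.nat x)⟩
  | id =>
    refine ⟨(gen_id h).1, fun x => holds_iff_of ?_⟩
    simp only [Fm.holds_ex]
    exact (gen_id h).2 x
  | co =>
    refine (Fm.holds_closure _ _).2 fun ρ ha => ?_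
    exact ⟨(gen_co h ha).1, fun x => holds_iff_of ((gen_co h ha).2 x)⟩
  | int =>
    refine (Fm.holds_closure _ _).2 fun ρ hab => ?_
    exact ⟨(gen_int h hab.1 hab.2).1, fun x => holds_iff_of ((gen_int h hab.1 hab.2).2 x)⟩
  | dom =>
    refine (Fm.holds_closure _ _).2 fun ρ ha => ⟨(gen_dom h ha).1, fun x => holds_iff_of ?_⟩
    simp only [Fm.holds_ex]
    exact (gen_dom h ha).2 x
  | inv =>
    refine (Fm.holds_closure _ _).2 fun ρ ha => ?_
    exact ⟨(gen_inv h ha).1, fun x => holds_iff_of ((gen_inv h ha).2 x)⟩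
  | join =>
    refine (Fm.holds_closure _ _).2 fun ρ hab => ?_
    refine ⟨(gen_join h hab.1 hab.2).1, fun x => holds_iff_of ?_⟩
    simp only [Fm.holds_ex]
    exact (gen_join h hab.1 hab.2).2 x

theorem reduct_models_T0 (h : M.Models KFUPI) : (M.reduct genTm).Models T0 := by
  intro A hA
  cases hA with
  | em hA => exact reduct_models_EM h A hA
  | ig1 =>
    refine (Fm.holds_closure _ _).2 fun ρ hab => ⟨C_acc h hab.1 hab.2, (holds_closedEM _ _ _ _).2 ?_⟩
    exact fun x hx hy => T_acc_of_closed h hab.1 hab.2 hx hy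
  | ig2 A =>
    refine (Fm.holds_closure _ _).2 fun ρ => ?_
    obtain ⟨ρ, v, rfl⟩ := exists_append ρ
    have hv (i : Fin 2) := Tm.eval_pv (X := Gen) (Y := EMRel) (M := M.reduct genTm) ρ v i
    have hS (i : Fin 2) : (isSet (pv _ i)).holds (M.reduct genTm) (Fin.append ρ v) ↔ M.C (v i) :=
      iff_of_eq (congrArg M.C (hv i))
    rintro ⟨ha, hb, hA⟩ x hx
    rw [hS] at ha hb
    rw [holds_closedEM, hv, hv] at hA
    -- The instance of (IG.2) for `A` is accessibility induction in `M` for the translation of `A`;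
    -- the remaining work matches the two assignments.
    refine (holds_trans _ A).1 (induction_on_acc h ha hb (trans genTm A) (Fin.append ρ v)
      (fun x hx hy => ?_) x ?_)
    · exact (holds_trans _ A).2 (hA x hx fun y hy₁ hy₂ => (holds_trans _ A).1 (hy y hy₁ hy₂))
    · have hw (i : Fin 3) : (pv _ i : EMTm _).eval (M.reduct genTm) (push (Fin.append ρ v) x) =
          push v x i := by
        rw [push_append]
        exact Tm.eval_pv ρ _ i
      have e : M.T (M.app (M.app (M.gen .ig) (M.pair
        ((pv _ (j := 3) 0 : EMTm _).eval (M.reduct genTm) (push (Fin.append ρ v) x))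
        ((pv _ (j := 3) 1 : EMTm _).eval (M.reduct genTm) (push (Fin.append ρ v) x))))
        ((pv _ (j := 3) 2 : EMTm _).eval (M.reduct genTm) (push (Fin.append ρ v) x))) := hx
      rw [hw, hw, hw] at e
      exact e

end Model

theorem trans_provable {A : EMFm 0} (hA : Provable T0 A) : Provable KFUPI (trans genTm A) :=
  provable_of_holds fun _ h => (Model.holds_trans _ A).2
    (Derives.sound (Model.reduct_models_T0 h) hA _ (by simp))

end FregeStructure

theorem mainTheorem6 :
    ∃ τ : FregeStructure.Gen → FregeStructure.FSTm 0,
      τ .ig = FregeStructure.acc ∧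
      (∀ A : FregeStructure.EMFm 0,
        FregeStructure.Provable FregeStructure.T0 A →
          FregeStructure.Provable FregeStructure.KFUPI (FregeStructure.trans τ A)) ∧
      (∀ (m : ℕ) (A : FregeStructure.FSFm (m + 2 + 1)),
        FregeStructure.Provable FregeStructure.KFUPI (FregeStructure.accInduction A)) :=
  ⟨FregeStructure.genTm, rfl, fun _ h => FregeStructure.trans_provable h,
    fun _ A => FregeStructure.accInduction_provable A⟩
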